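/- For positive integers $s_1,\dots,s_l$ let $$[s_1,\dots,s_l]=\frac{1}{(s_1-1)!\cdots(s_l-1)!}\sum_{n>0}\Big(\sum_{\substack{u_1v_1+\dots+u_lv_l=n\\ u_1>\dots>u_l>0,\ v_1,\dots,v_l>0}}v_1^{s_1-1}\cdots v_l^{s_l-1}\Big)q^n\in\mathbb{Q}[[q]],\qquad [\emptyset]=1,$$ a bracket of weight $s_1+\dots+s_l$ and length $l$. Let $\Delta=q\prod_{n\ge1}(1-q^n)^{24}$ be the cusp form of weight $12$ for $\mathrm{SL}_2(\mathbb{Z})$. By a representation of $\Delta$ we mean a formal finite $\mathbb{Q}$-linear combination of the symbols $[s_1,\dots,s_l]$ whose value in $\mathbb{Q}[[q]]$ is $\Delta$. Then: 1. For every $(a,b)\in\{(2,4),(4,6),(6,8),(8,10),(10,11),(11,12)\}$ there is exactly one representation of $\Delta$ in terms of $[a]$, $[b]$ and the brackets $[m,n]$ with $m+n=12$, and it is of the form $$\Delta=\frac{2^b+50}{2^b-2^a}\,(a-1)!\,[a]+\frac{2^a+50}{2^a-2^b}\,(b-1)!\,[b]+\sum_{m+n=12}d_{m,n}[m,n],\qquad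 d_{m,n}\in\mathbb{Q}.$$ 2. Every representation of $\Delta$ as a linear combination of $1$, the brackets $[a]$ with $1\le a\le 12$ and the brackets $[m,n]$ with $m+n=12$ is a linear combination of these six representations. More generally, every representation of $\Delta$ by brackets of weight at most $12$ and length at most $2$ (the generators of $\mathrm{Fil}^{W,L}_{12,2}(\mathcal{MD})$) is the sum of a linear combination of these six and of a linear relation among brackets of weight at most $11$ and length at most $2$. 3. With the convergent series $\zeta(s_1,\dots,s_l)=\sum_{n_1>\dots>n_l>0}n_1^{-s_1}\cdots n_l^{-s_l}$ one has $$\tfrac{5197}{691}\,\zeta(12)=168\,\zeta(5,7)+150\,\zeta(7,5)+28\,\zeta(9,3).$$ -/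

import Mathlib

open Finset PowerSeries

/-- The weight `s₁ + ⋯ + s_l` of an index `(s₁, …, s_l)` of positive integers. -/
def indexWeight (s : List ℕ+) : ℕ := (s.map PNat.val).sum

/-- The multiple divisor sum `σ_{r₁,…,r_l}(n) = ∑ v₁^{r₁} ⋯ v_l^{r_l}`, over all positive integers
`u₁ > ⋯ > u_l > 0` and `v₁, …, v_l > 0` with `u₁ v₁ + ⋯ + u_l v_l = n`.  All such `u_j`, `v_j` are
at most `n`, so that the sum ranges over a finite box. -/
def multipleDivisorSum (r : List ℕ) (n : ℕ) : ℕ :=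
  ∑ p ∈ (Fintype.piFinset fun _ : Fin r.length => Finset.Icc 1 n) ×ˢ
        (Fintype.piFinset fun _ : Fin r.length => Finset.Icc 1 n) with
      (∀ i j, i < j → p.1 j < p.1 i) ∧ ∑ j, p.1 j * p.2 j = n,
    ∏ j, p.2 j ^ r.get j

/-- The bracket `[s₁,…,s_l] = 1/((s₁-1)! ⋯ (s_l-1)!) ∑_n σ_{s₁-1,…,s_l-1}(n) qⁿ ∈ ℚ⟦q⟧`.
For `l ≥ 1` the coefficient of `q⁰` is zero; for `l = 0` the series is `[∅] = 1`. -/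
noncomputable def bracket (s : List ℕ+) : ℚ⟦X⟧ :=
  PowerSeries.mk fun n =>
    (multipleDivisorSum (s.map fun a : ℕ+ => (a : ℕ) - 1) n : ℚ) /
      (s.map fun a : ℕ+ => (((a : ℕ) - 1).factorial : ℚ)).prod

/-- The power series `∑_s r_s [s]` of a formal finite rational linear combination `r` of
indices. -/
noncomputable def evalBrackets (r : List ℕ+ →₀ ℚ) : ℚ⟦X⟧ :=
  Finsupp.linearCombination ℚ bracket r

/-- `r` represents the discriminant: `Δ = ∑_s r_s [s]`, as an identity of `q`-expansions. -/
def RepresentsDelta (r : List ℕ+ →₀ ℚ) : Prop :=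
  (evalBrackets r).map (algebraMap ℚ ℂ) =
    UpperHalfPlane.qExpansion 1 (CuspForm.discriminant : UpperHalfPlane → ℂ)

/-- The indices of weight at most `k` and length at most `l`: the brackets at these indices are
the generators of the bifiltered piece `Fil^{W,L}_{k,l}` of the algebra of brackets. -/
def indicesUpTo (k l : ℕ) : Set (List ℕ+) := {s | indexWeight s ≤ k ∧ s.length ≤ l}

/-- The indices `(m, n)` of length two with `m + n = k`. -/
def pairIndices (k : ℕ) : Set (List ℕ+) := {s | indexWeight s = k ∧ s.length = 2}

/-- The six pairs `(a, b)`. -/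
def deltaPairs : Finset (ℕ+ × ℕ+) := {(2, 4), (4, 6), (6, 8), (8, 10), (10, 11), (11, 12)}

/-- The general term `n₁^{-s₁} ⋯ n_l^{-s_l}`, `n₁ > ⋯ > n_l > 0`, of a multiple zeta value. -/
noncomputable def mzvTerm (s : List ℕ+) (n : {n : Fin s.length → ℕ+ // StrictAnti n}) : ℝ :=
  ∏ j, ((n.1 j : ℝ) ^ (s.get j : ℕ))⁻¹

/-- The multiple zeta value `ζ(s₁,…,s_l) = ∑_{n₁ > ⋯ > n_l > 0} n₁^{-s₁} ⋯ n_l^{-s_l}`. -/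
noncomputable def multizeta (s : List ℕ+) : ℝ := ∑' n, mzvTerm s n

/-! Existence. Since E₄² = E₈, one has 1728Δ = E₄E₈ − E₆², so the coefficients of Δ are combinations
of σ₃, σ₅, σ₇ and of the convolutions σ₃∗σ₇ and σ₅∗σ₅. The convolution σ_r∗σ_s at n is the sum of
v₁^r v₂^s over u₁v₁ + u₂v₂ = n. Splitting it by the order of u₁ and u₂ gives a stuffle relation
(`divisorSumConv_stuffle`). Exchanging each uᵢ with vᵢ first and then conjugating partitions gives a
shuffle relation (`divisorSumConv_shuffle`). For r + s = 10 both lead to the [m,n] with m + n = 12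
and to brackets of length one, up to a term nσ₉(n) in the shuffle relations, which cancels when
their coefficients add up to 0. Each of the six representations is such a combination. Brackets of
length two start at q³ or later, so the coefficients 1 and −24 of q and q² in Δ alone dictate the
coefficients of [a] and [b].

Completeness. Two representations differ by a linear relation between brackets. A functional on the
coefficients of q⁰, …, q⁵³ that kills all brackets of weight at most 11 and length at most 2 turns
such a relation into one equation for its twelve coefficients of weight 12. Seven explicit
functionals leave five free parameters (`weight_twelve_equations`), which is the number of
independent differences of the six representations. Subtracting a suitable affine combination of the
six therefore leaves a relation of weight at most 11 (`exists_sub_support_subset`). If [m,n] occurs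
only in weight 12, that relation has length at most one, and it is trivial because brackets of
length at most one are independent (`eq_zero_of_evalBrackets_eq_zero`).

Zeta values. The last identity is proved without brackets, from the double shuffle relations of the
zeta values themselves and Euler's formula, by which ζ(4)ζ(8) and ζ(6)² are rational multiples of
ζ(12) (`zetaSum_twelve_relation`). -/

/-! ### Divisor sums of length at most two as sums over factorizations -/

open ArithmeticFunction in
theorem multipleDivisorSum_singleton (r n : ℕ) : multipleDivisorSum [r] n = sigma r n := by
  rw [sigma_apply, ← Nat.sum_divisorsAntidiagonal' (fun _ d => d ^ r), multipleDivisorSum]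
  refine Finset.sum_nbij' (fun p => (p.1 0, p.2 0)) (fun x => (fun _ => x.1, fun _ => x.2))
    ?_ ?_ ?_ ?_ ?_
  · rintro ⟨p, q⟩ h
    simp only [List.length_cons, List.length_nil, Finset.mem_filter, mem_product,
      Fintype.mem_piFinset, Finset.mem_Icc] at h
    obtain ⟨⟨h1, h2⟩, -, h3⟩ := h
    have := h1 0
    simp only [Nat.mem_divisorsAntidiagonal]
    exact ⟨by simpa using h3, by omega⟩
  · rintro ⟨x, y⟩ h
    obtain ⟨h, hn⟩ := Nat.mem_divisorsAntidiagonal.1 h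
    have hx : 0 < x := Nat.pos_of_ne_zero (by rintro rfl; simp at h; omega)
    have hy : 0 < y := Nat.pos_of_ne_zero (by rintro rfl; simp at h; omega)
    have hxn : x ≤ n := by simp only at h; nlinarith
    have hyn : y ≤ n := by simp only at h; nlinarith
    simp only [List.length_cons, List.length_nil, Finset.mem_filter, mem_product,
      Fintype.mem_piFinset, Finset.mem_Icc]
    exact ⟨⟨fun _ => ⟨hx, hxn⟩, fun _ => ⟨hy, hyn⟩⟩,
      fun i j hij => absurd hij (by have := i.2; have := j.2; simp only at *; omega), h⟩
  · rintro ⟨p, q⟩ -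
    ext i <;> (have := Subsingleton.elim (α := Fin 1) i 0; subst this; rfl)
  · intros; rfl
  · rintro ⟨p, q⟩ -
    simp

/-- The pairs of pairs `((u₁, v₁), (u₂, v₂))` of positive integers with `u₁ v₁ + u₂ v₂ = n`. -/
def quadruples (n : ℕ) : Finset ((ℕ × ℕ) × (ℕ × ℕ)) :=
  ((Finset.Icc 1 n ×ˢ Finset.Icc 1 n) ×ˢ (Finset.Icc 1 n ×ˢ Finset.Icc 1 n)).filter
    fun p => p.1.1 * p.1.2 + p.2.1 * p.2.2 = n

/-- Positivity already forces every entry to be at most n, so the box in the definition can be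
forgotten. -/
theorem mem_quadruples {n : ℕ} {p : (ℕ × ℕ) × (ℕ × ℕ)} :
    p ∈ quadruples n ↔ (0 < p.1.1 ∧ 0 < p.1.2 ∧ 0 < p.2.1 ∧ 0 < p.2.2) ∧
      p.1.1 * p.1.2 + p.2.1 * p.2.2 = n := by
  obtain ⟨⟨a, b⟩, c, d⟩ := p
  simp only [quadruples, Finset.mem_filter, mem_product, Finset.mem_Icc]
  constructor
  · rintro ⟨⟨⟨h1, h2⟩, h3, h4⟩, h⟩
    exact ⟨⟨h1.1, h2.1, h3.1, h4.1⟩, h⟩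
  · rintro ⟨⟨h1, h2, h3, h4⟩, h⟩
    refine ⟨⟨⟨⟨h1, ?_⟩, h2, ?_⟩, ⟨h3, ?_⟩, h4, ?_⟩, h⟩ <;> nlinarith

/-- The quadruples with `u₁ > u₂`. -/
def decreasingQuadruples (n : ℕ) : Finset ((ℕ × ℕ) × (ℕ × ℕ)) :=
  (quadruples n).filter fun p => p.2.1 < p.1.1

theorem multipleDivisorSum_pair (r s n : ℕ) :
    multipleDivisorSum [r, s] n = ∑ p ∈ decreasingQuadruples n, p.1.2 ^ r * p.2.2 ^ s := by
  rw [multipleDivisorSum]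
  refine Finset.sum_nbij' (fun p => ((p.1 ⟨0, by simp⟩, p.2 ⟨0, by simp⟩),
    (p.1 ⟨1, by simp⟩, p.2 ⟨1, by simp⟩)))
    (fun x => ((![x.1.1, x.2.1] : Fin 2 → ℕ), (![x.1.2, x.2.2] : Fin 2 → ℕ))) ?_ ?_ ?_ ?_ ?_
  · rintro ⟨p, q⟩ h
    simp only [Finset.mem_filter, mem_product, Fintype.mem_piFinset, Finset.mem_Icc] at h
    obtain ⟨⟨h1, h2⟩, h3, h4⟩ := h
    simp only [decreasingQuadruples, Finset.mem_filter, mem_quadruples]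
    exact ⟨⟨⟨(h1 _).1, (h2 _).1, (h1 _).1, (h2 _).1⟩,
      (Fin.sum_univ_two (fun j : Fin 2 => p j * q j)).symm.trans h4⟩, h3 _ _ (by simp)⟩
  · rintro ⟨⟨a, b⟩, c, d⟩ h
    have h0 := h
    simp only [decreasingQuadruples, Finset.mem_filter, mem_quadruples] at h
    simp only [decreasingQuadruples, quadruples, Finset.mem_filter, mem_product] at h0
    obtain ⟨⟨⟨⟨ha, hb⟩, hc, hd⟩, h4⟩, h5⟩ := h0
    simp only [Finset.mem_filter, mem_product, Fintype.mem_piFinset]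
    refine ⟨⟨fun i : Fin 2 => ?_, fun i : Fin 2 => ?_⟩, fun i j : Fin 2 => ?_, ?_⟩
    · fin_cases i
      · exact ha
      · exact hc
    · fin_cases i
      · exact hb
      · exact hd
    · fin_cases i <;> fin_cases j <;> simp [h5]
    · exact (Fin.sum_univ_two _).trans h4
  · rintro ⟨p, q⟩ -
    refine Prod.ext ?_ ?_ <;> (funext (i : Fin 2); fin_cases i <;> rfl)
  · intros; rfl
  · rintro ⟨p, q⟩ -
    exact Fin.prod_univ_two (fun j : Fin 2 => q j ^ [r, s].get j)

theorem multipleDivisorSum_nil {n : ℕ} (hn : n ≠ 0) : multipleDivisorSum [] n = 0 := by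
  rw [multipleDivisorSum]
  refine Finset.sum_eq_zero ?_
  rintro ⟨p, q⟩ h
  simp only [Finset.mem_filter, List.length_nil, univ_eq_empty, sum_empty] at h
  exact absurd h.2.2.symm hn

/-- The divisor sum `σ_r(n)` as a rational number. -/
def divisorSum (r n : ℕ) : ℚ := ArithmeticFunction.sigma r n

theorem divisorSum_eq_sum_divisorsAntidiagonal (r n : ℕ) :
    divisorSum r n = ∑ x ∈ n.divisorsAntidiagonal, (x.2 : ℚ) ^ r := by
  rw [divisorSum, ArithmeticFunction.sigma_apply, ← Nat.sum_divisorsAntidiagonal' (fun _ d => d ^ r)]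
  push_cast
  rfl

theorem divisorSum_eq_sum_divisorsAntidiagonal' (r n : ℕ) :
    divisorSum r n = ∑ x ∈ n.divisorsAntidiagonal, (x.1 : ℚ) ^ r := by
  rw [divisorSum, ArithmeticFunction.sigma_apply, ← Nat.sum_divisorsAntidiagonal (fun d _ => d ^ r)]
  push_cast
  rfl

/-- The double divisor sum as a rational number. -/
def doubleDivisorSum (r s n : ℕ) : ℚ := multipleDivisorSum [r, s] n

theorem doubleDivisorSum_eq_sum (r s n : ℕ) :
    doubleDivisorSum r s n = ∑ p ∈ decreasingQuadruples n, (p.1.2 : ℚ) ^ r * (p.2.2 : ℚ) ^ s := by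
  rw [doubleDivisorSum, multipleDivisorSum_pair]
  push_cast
  rfl

/-! ### Stuffle and shuffle relations for convolutions of divisor sums -/

/-- The convolution of two divisor sums. -/
def divisorSumConv (r s n : ℕ) : ℚ :=
  ∑ x ∈ antidiagonal n, divisorSum r x.1 * divisorSum s x.2

theorem divisorSumConv_eq_sum (r s n : ℕ) :
    divisorSumConv r s n = ∑ p ∈ quadruples n, (p.1.2 : ℚ) ^ r * (p.2.2 : ℚ) ^ s := by
  simp only [divisorSumConv, divisorSum_eq_sum_divisorsAntidiagonal, Finset.sum_mul_sum, ← sum_product',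
    Finset.sum_sigma']
  refine Finset.sum_nbij' (fun x => x.2) (fun p => ⟨(p.1.1 * p.1.2, p.2.1 * p.2.2), p⟩)
    ?_ ?_ ?_ ?_ ?_
  · rintro ⟨⟨i, j⟩, ⟨a, b⟩, c, d⟩ h
    simp only [Finset.mem_sigma, HasAntidiagonal.mem_antidiagonal, mem_product, Nat.mem_divisorsAntidiagonal] at h
    obtain ⟨rfl, ⟨rfl, h1⟩, rfl, h2⟩ := h
    simp only [ne_eq, mul_eq_zero, not_or] at h1 h2
    simp only [mem_quadruples, and_true]
    omega
  · rintro ⟨⟨a, b⟩, c, d⟩ h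
    obtain ⟨⟨h1, h2, h3, h4⟩, h⟩ := mem_quadruples.1 h
    simp only [Finset.mem_sigma, HasAntidiagonal.mem_antidiagonal, mem_product, Nat.mem_divisorsAntidiagonal]
    exact ⟨h, ⟨trivial, (Nat.mul_pos h1 h2).ne'⟩, trivial, (Nat.mul_pos h3 h4).ne'⟩
  · rintro ⟨⟨i, j⟩, ⟨a, b⟩, c, d⟩ h
    simp only [Finset.mem_sigma, HasAntidiagonal.mem_antidiagonal, mem_product, Nat.mem_divisorsAntidiagonal] at h
    obtain ⟨rfl, ⟨rfl, h1⟩, rfl, h2⟩ := h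
    rfl
  · intros; rfl
  · intros; rfl

/-- A sum over quadruples splits according to `u₁ > u₂`, `u₁ < u₂` or `u₁ = u₂`. -/
theorem sum_quadruples (n : ℕ) (f : (ℕ × ℕ) × (ℕ × ℕ) → ℚ) :
    ∑ p ∈ quadruples n, f p = ∑ p ∈ decreasingQuadruples n, f p +
      ∑ p ∈ decreasingQuadruples n, f p.swap +
      ∑ x ∈ n.divisorsAntidiagonal, ∑ i ∈ Finset.Ico 1 x.2, f ((x.1, i), (x.1, x.2 - i)) := by
  have h1 : ∑ p ∈ decreasingQuadruples n, f p.swap =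
      ∑ p ∈ (quadruples n).filter (fun p => ¬ p.2.1 < p.1.1) with p.1.1 < p.2.1, f p := by
    refine Finset.sum_nbij' Prod.swap Prod.swap ?_ ?_ ?_ ?_ ?_
    · rintro ⟨⟨a, b⟩, c, d⟩ h
      simp only [decreasingQuadruples, Finset.mem_filter, mem_quadruples, Prod.swap] at h ⊢
      omega
    · rintro ⟨⟨a, b⟩, c, d⟩ h
      simp only [decreasingQuadruples, Finset.mem_filter, mem_quadruples, Prod.swap] at h ⊢
      omega
    all_goals intros; rfl
  -- In the remaining case u₁ = u₂ = u one has n = u(v₁ + v₂); the quadruple is recorded by the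
  -- factorization (u, v₁ + v₂) of n together with i = v₁.
  have h2 : ∑ x ∈ n.divisorsAntidiagonal, ∑ i ∈ Finset.Ico 1 x.2, f ((x.1, i), (x.1, x.2 - i)) =
      ∑ p ∈ (quadruples n).filter (fun p => ¬ p.2.1 < p.1.1) with ¬ p.1.1 < p.2.1, f p := by
    rw [Finset.sum_sigma']
    refine Finset.sum_nbij' (fun x => ((x.1.1, x.2), (x.1.1, x.1.2 - x.2)))
      (fun p => ⟨(p.1.1, p.1.2 + p.2.2), p.1.2⟩) ?_ ?_ ?_ ?_ ?_
    · rintro ⟨⟨a, b⟩, i⟩ h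
      simp only [Finset.mem_sigma, Nat.mem_divisorsAntidiagonal, Finset.mem_Ico] at h
      obtain ⟨⟨rfl, h0⟩, h1, h2⟩ := h
      obtain ⟨j, rfl⟩ := Nat.exists_eq_add_of_lt h2
      simp only [ne_eq, mul_eq_zero, not_or] at h0
      simp only [Finset.mem_filter, mem_quadruples]
      refine ⟨⟨⟨by omega, ?_⟩, by omega⟩, by omega⟩
      rw [← mul_add]; congr 1; omega
    · rintro ⟨⟨a, b⟩, c, d⟩ h
      simp only [Finset.mem_filter, mem_quadruples] at h
      obtain ⟨⟨⟨⟨h1, h2, h3, h4⟩, rfl⟩, h5⟩, h6⟩ := h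
      obtain rfl : a = c := by omega
      simp only [Finset.mem_sigma, Nat.mem_divisorsAntidiagonal, Finset.mem_Ico]
      exact ⟨⟨by ring, by positivity⟩, by omega⟩
    · rintro ⟨⟨a, b⟩, i⟩ h
      simp only [Finset.mem_sigma, Nat.mem_divisorsAntidiagonal, Finset.mem_Ico] at h
      simp only [Sigma.mk.injEq, Prod.mk.injEq, true_and, heq_eq_eq, and_true]
      omega
    · rintro ⟨⟨a, b⟩, c, d⟩ h
      simp only [Finset.mem_filter, mem_quadruples] at h
      simp only [Prod.mk.injEq, true_and]
      omega
    · intros; rfl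
  rw [h1, h2, ← Finset.sum_filter_add_sum_filter_not (quadruples n) (fun p => p.2.1 < p.1.1),
    ← Finset.sum_filter_add_sum_filter_not ((quadruples n).filter fun p => ¬ p.2.1 < p.1.1)
      (fun p => p.1.1 < p.2.1), add_assoc, decreasingQuadruples]

/-- The stuffle product of two divisor sums. -/
theorem divisorSumConv_stuffle (r s n : ℕ) :
    divisorSumConv r s n = doubleDivisorSum r s n + doubleDivisorSum s r n +
      ∑ x ∈ n.divisorsAntidiagonal, ∑ i ∈ Finset.Ico 1 x.2, (i : ℚ) ^ r * ((x.2 : ℚ) - i) ^ s := by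
  rw [divisorSumConv_eq_sum, sum_quadruples, doubleDivisorSum_eq_sum, doubleDivisorSum_eq_sum]
  congr 1
  · congr 1
    exact Finset.sum_congr rfl fun p _ => mul_comm _ _
  · refine Finset.sum_congr rfl fun x _ => Finset.sum_congr rfl fun i hi => ?_
    rw [Nat.cast_sub (Finset.mem_Ico.1 hi).2.le]

/-- Conjugation of partitions with two different parts. -/
theorem sum_decreasingQuadruples_conj (n : ℕ) (f : (ℕ × ℕ) × (ℕ × ℕ) → ℚ) :
    ∑ p ∈ decreasingQuadruples n, f p =
      ∑ p ∈ decreasingQuadruples n, f ((p.1.2 + p.2.2, p.2.1), (p.1.2, p.1.1 - p.2.1)) := by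
  -- The quadruple is the partition of n into v₁ parts u₁ and v₂ parts u₂. Transposing its diagram
  -- reads n as (v₁ + v₂)u₂ + v₁(u₁ − u₂). The map is an involution, so it serves as its own inverse
  -- below.
  have key : ∀ p ∈ decreasingQuadruples n,
      ((p.1.2 + p.2.2, p.2.1), (p.1.2, p.1.1 - p.2.1)) ∈ decreasingQuadruples n := by
    rintro ⟨⟨a, b⟩, c, d⟩ h
    simp only [decreasingQuadruples, Finset.mem_filter, mem_quadruples] at h ⊢
    obtain ⟨⟨⟨h1, h2, h3, h4⟩, rfl⟩, h5⟩ := h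
    obtain ⟨j, rfl⟩ := Nat.exists_eq_add_of_lt h5
    refine ⟨⟨by omega, ?_⟩, by omega⟩
    rw [show c + j + 1 - c = j + 1 by omega]
    ring
  have inv : ∀ p ∈ decreasingQuadruples n,
      ((p.2.1 + (p.1.1 - p.2.1), p.1.2), (p.2.1, (p.1.2 + p.2.2) - p.1.2)) = p := by
    rintro ⟨⟨a, b⟩, c, d⟩ h
    simp only [decreasingQuadruples, Finset.mem_filter, mem_quadruples] at h
    simp only [Prod.mk.injEq, true_and, and_true]
    omega
  refine Finset.sum_nbij' (fun p => ((p.1.2 + p.2.2, p.2.1), (p.1.2, p.1.1 - p.2.1)))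
    (fun p => ((p.1.2 + p.2.2, p.2.1), (p.1.2, p.1.1 - p.2.1))) key key inv inv ?_
  intro p hp
  simp only [inv p hp]

/-- This moves the exponents from the vᵢ to the uᵢ; conjugation then turns u₁ and u₂ into v₁ + v₂
and v₁. -/
theorem sum_quadruples_swap (n : ℕ) (f : (ℕ × ℕ) × (ℕ × ℕ) → ℚ) :
    ∑ p ∈ quadruples n, f p = ∑ p ∈ quadruples n, f (p.1.swap, p.2.swap) := by
  refine Finset.sum_nbij' (fun p => (p.1.swap, p.2.swap)) (fun p => (p.1.swap, p.2.swap))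
    ?_ ?_ ?_ ?_ ?_
  · rintro ⟨⟨a, b⟩, c, d⟩ h
    simp only [mem_quadruples, Prod.swap] at h ⊢
    rw [mul_comm b, mul_comm d]
    tauto
  · rintro ⟨⟨a, b⟩, c, d⟩ h
    simp only [mem_quadruples, Prod.swap] at h ⊢
    rw [mul_comm b, mul_comm d]
    tauto
  all_goals intros; rfl

/-- The left side is what conjugation produces; the binomial theorem brings it back to double
divisor sums with the same total exponent. -/
theorem sum_add_pow_mul_pow (r s n : ℕ) :
    ∑ p ∈ decreasingQuadruples n, ((p.1.2 : ℚ) + p.2.2) ^ r * (p.1.2 : ℚ) ^ s =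
      ∑ k ∈ Finset.range (r + 1), (r.choose k : ℚ) * doubleDivisorSum (s + k) (r - k) n := by
  simp only [doubleDivisorSum_eq_sum, Finset.mul_sum]
  rw [Finset.sum_comm]
  refine Finset.sum_congr rfl fun p _ => ?_
  rw [add_pow, Finset.sum_mul]
  refine Finset.sum_congr rfl fun k _ => ?_
  rw [pow_add]
  ring

/-- The shuffle product of two divisor sums. -/
theorem divisorSumConv_shuffle (r s n m : ℕ) (hm : r + s = m + 1) :
    divisorSumConv r s n =
      ∑ k ∈ Finset.range (r + 1), (r.choose k : ℚ) * doubleDivisorSum (s + k) (r - k) n +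
      ∑ k ∈ Finset.range (s + 1), (s.choose k : ℚ) * doubleDivisorSum (r + k) (s - k) n +
      (n * divisorSum m n - divisorSum (m + 1) n) := by
  rw [divisorSumConv_eq_sum, sum_quadruples_swap, sum_quadruples, ← sum_add_pow_mul_pow,
    ← sum_add_pow_mul_pow]
  congr 1
  · congr 1
    · rw [sum_decreasingQuadruples_conj]
      refine Finset.sum_congr rfl fun p _ => ?_
      simp
    · rw [sum_decreasingQuadruples_conj]
      refine Finset.sum_congr rfl fun p _ => ?_
      simp [mul_comm]
  -- On the diagonal the summand is u^(m+1), and v splits into two positive parts in v − 1 ways;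
  -- with uv = n, u^(m+1)(v − 1) = n u^m − u^(m+1).
  · rw [divisorSum_eq_sum_divisorsAntidiagonal', divisorSum_eq_sum_divisorsAntidiagonal', Finset.mul_sum,
      ← Finset.sum_sub_distrib]
    refine Finset.sum_congr rfl fun x hx => ?_
    obtain ⟨rfl, h0⟩ := Nat.mem_divisorsAntidiagonal.1 hx
    have h2 : 1 ≤ x.2 := Nat.pos_of_ne_zero fun h => h0 (by simp [h])
    simp only [Prod.swap, ← pow_add, hm, Finset.sum_const,
      Nat.card_Ico, nsmul_eq_mul, Nat.cast_sub h2]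
    push_cast
    ring

/-! ### The stuffle and shuffle relations of weight twelve -/

/-- A telescoping sum: Faulhaber's polynomial is characterized by its difference equation and by its
value at 1, where the range is empty. -/
theorem sum_Ico_pow_eq (k v : ℕ) (p : ℚ → ℚ) (h1 : p 1 = 0) (hp : ∀ x, p (x + 1) = p x + x ^ k)
    (hv : 1 ≤ v) : ∑ i ∈ Finset.Ico 1 v, (i : ℚ) ^ k = p v := by
  induction v, hv using Nat.le_induction with
  | base => simp [h1]
  | succ m hm ih => rw [Finset.sum_Ico_succ_top hm, ih, Nat.cast_add, Nat.cast_one, hp]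

theorem sum_Ico_pow_0 (v : ℕ) (hv : 1 ≤ v) : ∑ i ∈ Finset.Ico 1 v, (i : ℚ) ^ 0 =
    1 * (v : ℚ) ^ 1 - 1 * (v : ℚ) ^ 0 :=
  sum_Ico_pow_eq 0 v (fun x => 1 * x ^ 1 - 1 * x ^ 0)
    (by norm_num) (fun x => by ring) hv

theorem sum_Ico_pow_1 (v : ℕ) (hv : 1 ≤ v) : ∑ i ∈ Finset.Ico 1 v, (i : ℚ) ^ 1 =
    (1/2) * (v : ℚ) ^ 2 - (1/2) * (v : ℚ) ^ 1 :=
  sum_Ico_pow_eq 1 v (fun x => (1/2) * x ^ 2 - (1/2) * x ^ 1)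
    (by norm_num) (fun x => by ring) hv

theorem sum_Ico_pow_2 (v : ℕ) (hv : 1 ≤ v) : ∑ i ∈ Finset.Ico 1 v, (i : ℚ) ^ 2 =
    (1/3) * (v : ℚ) ^ 3 - (1/2) * (v : ℚ) ^ 2 + (1/6) * (v : ℚ) ^ 1 :=
  sum_Ico_pow_eq 2 v (fun x => (1/3) * x ^ 3 - (1/2) * x ^ 2 + (1/6) * x ^ 1)
    (by norm_num) (fun x => by ring) hv

theorem sum_Ico_pow_3 (v : ℕ) (hv : 1 ≤ v) : ∑ i ∈ Finset.Ico 1 v, (i : ℚ) ^ 3 =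
    (1/4) * (v : ℚ) ^ 4 - (1/2) * (v : ℚ) ^ 3 + (1/4) * (v : ℚ) ^ 2 :=
  sum_Ico_pow_eq 3 v (fun x => (1/4) * x ^ 4 - (1/2) * x ^ 3 + (1/4) * x ^ 2)
    (by norm_num) (fun x => by ring) hv

theorem sum_Ico_pow_4 (v : ℕ) (hv : 1 ≤ v) : ∑ i ∈ Finset.Ico 1 v, (i : ℚ) ^ 4 =
    (1/5) * (v : ℚ) ^ 5 - (1/2) * (v : ℚ) ^ 4 + (1/3) * (v : ℚ) ^ 3 - (1/30) * (v : ℚ) ^ 1 :=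
  sum_Ico_pow_eq 4 v (fun x => (1/5) * x ^ 5 - (1/2) * x ^ 4 + (1/3) * x ^ 3 - (1/30) * x ^ 1)
    (by norm_num) (fun x => by ring) hv

theorem sum_Ico_pow_5 (v : ℕ) (hv : 1 ≤ v) : ∑ i ∈ Finset.Ico 1 v, (i : ℚ) ^ 5 =
    (1/6) * (v : ℚ) ^ 6 - (1/2) * (v : ℚ) ^ 5 + (5/12) * (v : ℚ) ^ 4 - (1/12) * (v : ℚ) ^ 2 :=
  sum_Ico_pow_eq 5 v (fun x => (1/6) * x ^ 6 - (1/2) * x ^ 5 + (5/12) * x ^ 4 - (1/12) * x ^ 2)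
    (by norm_num) (fun x => by ring) hv

theorem sum_Ico_pow_6 (v : ℕ) (hv : 1 ≤ v) : ∑ i ∈ Finset.Ico 1 v, (i : ℚ) ^ 6 =
    (1/7) * (v : ℚ) ^ 7 - (1/2) * (v : ℚ) ^ 6 + (1/2) * (v : ℚ) ^ 5 - (1/6) * (v : ℚ) ^ 3 + (1/42) * (v : ℚ) ^ 1 :=
  sum_Ico_pow_eq 6 v (fun x => (1/7) * x ^ 7 - (1/2) * x ^ 6 + (1/2) * x ^ 5 - (1/6) * x ^ 3 + (1/42) * x ^ 1)
    (by norm_num) (fun x => by ring) hv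

theorem sum_Ico_pow_7 (v : ℕ) (hv : 1 ≤ v) : ∑ i ∈ Finset.Ico 1 v, (i : ℚ) ^ 7 =
    (1/8) * (v : ℚ) ^ 8 - (1/2) * (v : ℚ) ^ 7 + (7/12) * (v : ℚ) ^ 6 - (7/24) * (v : ℚ) ^ 4 + (1/12) * (v : ℚ) ^ 2 :=
  sum_Ico_pow_eq 7 v (fun x => (1/8) * x ^ 8 - (1/2) * x ^ 7 + (7/12) * x ^ 6 - (7/24) * x ^ 4 + (1/12) * x ^ 2)
    (by norm_num) (fun x => by ring) hv

theorem sum_Ico_pow_8 (v : ℕ) (hv : 1 ≤ v) : ∑ i ∈ Finset.Ico 1 v, (i : ℚ) ^ 8 =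
    (1/9) * (v : ℚ) ^ 9 - (1/2) * (v : ℚ) ^ 8 + (2/3) * (v : ℚ) ^ 7 - (7/15) * (v : ℚ) ^ 5 + (2/9) * (v : ℚ) ^ 3 - (1/30) * (v : ℚ) ^ 1 :=
  sum_Ico_pow_eq 8 v (fun x => (1/9) * x ^ 9 - (1/2) * x ^ 8 + (2/3) * x ^ 7 - (7/15) * x ^ 5 + (2/9) * x ^ 3 - (1/30) * x ^ 1)
    (by norm_num) (fun x => by ring) hv

theorem sum_Ico_pow_9 (v : ℕ) (hv : 1 ≤ v) : ∑ i ∈ Finset.Ico 1 v, (i : ℚ) ^ 9 =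
    (1/10) * (v : ℚ) ^ 10 - (1/2) * (v : ℚ) ^ 9 + (3/4) * (v : ℚ) ^ 8 - (7/10) * (v : ℚ) ^ 6 + (1/2) * (v : ℚ) ^ 4 - (3/20) * (v : ℚ) ^ 2 :=
  sum_Ico_pow_eq 9 v (fun x => (1/10) * x ^ 10 - (1/2) * x ^ 9 + (3/4) * x ^ 8 - (7/10) * x ^ 6 + (1/2) * x ^ 4 - (3/20) * x ^ 2)
    (by norm_num) (fun x => by ring) hv

theorem sum_Ico_pow_10 (v : ℕ) (hv : 1 ≤ v) : ∑ i ∈ Finset.Ico 1 v, (i : ℚ) ^ 10 =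
    (1/11) * (v : ℚ) ^ 11 - (1/2) * (v : ℚ) ^ 10 + (5/6) * (v : ℚ) ^ 9 - 1 * (v : ℚ) ^ 7 + 1 * (v : ℚ) ^ 5 - (1/2) * (v : ℚ) ^ 3 + (5/66) * (v : ℚ) ^ 1 :=
  sum_Ico_pow_eq 10 v (fun x => (1/11) * x ^ 11 - (1/2) * x ^ 10 + (5/6) * x ^ 9 - 1 * x ^ 7 + 1 * x ^ 5 - (1/2) * x ^ 3 + (5/66) * x ^ 1)
    (by norm_num) (fun x => by ring) hv

/-- This is the diagonal of the stuffle relation. It is a polynomial in v with leading coefficient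
r! s!/(r + s + 1)!, so summation over the divisors v of n gives single divisor sums. -/
theorem sum_Ico_pow_0_mul_pow_10 (v : ℕ) (hv : 1 ≤ v) :
    ∑ i ∈ Finset.Ico 1 v, (i : ℚ) ^ 0 * ((v : ℚ) - i) ^ 10 =
      (1/11) * (v : ℚ) ^ 11 - (1/2) * (v : ℚ) ^ 10 + (5/6) * (v : ℚ) ^ 9 - 1 * (v : ℚ) ^ 7 + 1 * (v : ℚ) ^ 5 - (1/2) * (v : ℚ) ^ 3 + (5/66) * (v : ℚ) ^ 1 := by
  have h : ∀ i : ℕ, (i : ℚ) ^ 0 * ((v : ℚ) - i) ^ 10 =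
      (1 * v ^ 10) * (i : ℚ) ^ 0 + (-10 * v ^ 9) * (i : ℚ) ^ 1 + (45 * v ^ 8) * (i : ℚ) ^ 2 + (-120 * v ^ 7) * (i : ℚ) ^ 3 + (210 * v ^ 6) * (i : ℚ) ^ 4 + (-252 * v ^ 5) * (i : ℚ) ^ 5 + (210 * v ^ 4) * (i : ℚ) ^ 6 + (-120 * v ^ 3) * (i : ℚ) ^ 7 + (45 * v ^ 2) * (i : ℚ) ^ 8 + (-10 * v ^ 1) * (i : ℚ) ^ 9 + (1 * v ^ 0) * (i : ℚ) ^ 10 := fun i => by ring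
  simp only [h, Finset.sum_add_distrib, ← Finset.mul_sum, sum_Ico_pow_0 v hv, sum_Ico_pow_1 v hv, sum_Ico_pow_2 v hv, sum_Ico_pow_3 v hv, sum_Ico_pow_4 v hv, sum_Ico_pow_5 v hv, sum_Ico_pow_6 v hv, sum_Ico_pow_7 v hv, sum_Ico_pow_8 v hv, sum_Ico_pow_9 v hv, sum_Ico_pow_10 v hv]
  ring

theorem stuffle_0_10 (n : ℕ) : divisorSumConv 0 10 n = doubleDivisorSum 0 10 n + doubleDivisorSum 10 0 n +
    ((1/11) * divisorSum 11 n - (1/2) * divisorSum 10 n + (5/6) * divisorSum 9 n - 1 * divisorSum 7 n + 1 * divisorSum 5 n - (1/2) * divisorSum 3 n + (5/66) * divisorSum 1 n) := by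
  rw [divisorSumConv_stuffle]
  congr 1
  simp only [divisorSum_eq_sum_divisorsAntidiagonal, Finset.mul_sum, ← Finset.sum_add_distrib,
    ← Finset.sum_sub_distrib]
  refine Finset.sum_congr rfl fun x hx => ?_
  obtain ⟨rfl, h0⟩ := Nat.mem_divisorsAntidiagonal.1 hx
  rw [sum_Ico_pow_0_mul_pow_10 _ (Nat.pos_of_ne_zero fun h => h0 (by simp [h]))]

/-- The term nσ₉(n), a multiple of the coefficient of the derivative q d/dq of [10], is the same in
all shuffle relations with r + s = 10. It drops out of every combination in which their coefficients
add up to zero. -/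
theorem shuffle_0_10 (n : ℕ) : divisorSumConv 0 10 n =
    1 * doubleDivisorSum 0 10 n + 10 * doubleDivisorSum 1 9 n + 45 * doubleDivisorSum 2 8 n + 120 * doubleDivisorSum 3 7 n + 210 * doubleDivisorSum 4 6 n + 252 * doubleDivisorSum 5 5 n + 210 * doubleDivisorSum 6 4 n + 120 * doubleDivisorSum 7 3 n + 45 * doubleDivisorSum 8 2 n + 10 * doubleDivisorSum 9 1 n + 2 * doubleDivisorSum 10 0 n +
    (n * divisorSum 9 n - divisorSum 10 n) := by
  rw [divisorSumConv_shuffle 0 10 n 9 rfl]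
  simp [Finset.sum_range_succ, Nat.choose]
  ring

theorem sum_Ico_pow_1_mul_pow_9 (v : ℕ) (hv : 1 ≤ v) :
    ∑ i ∈ Finset.Ico 1 v, (i : ℚ) ^ 1 * ((v : ℚ) - i) ^ 9 =
      (1/110) * (v : ℚ) ^ 11 - (1/12) * (v : ℚ) ^ 9 + (3/10) * (v : ℚ) ^ 7 - (1/2) * (v : ℚ) ^ 5 + (7/20) * (v : ℚ) ^ 3 - (5/66) * (v : ℚ) ^ 1 := by
  have h : ∀ i : ℕ, (i : ℚ) ^ 1 * ((v : ℚ) - i) ^ 9 =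
      (1 * v ^ 9) * (i : ℚ) ^ 1 + (-9 * v ^ 8) * (i : ℚ) ^ 2 + (36 * v ^ 7) * (i : ℚ) ^ 3 + (-84 * v ^ 6) * (i : ℚ) ^ 4 + (126 * v ^ 5) * (i : ℚ) ^ 5 + (-126 * v ^ 4) * (i : ℚ) ^ 6 + (84 * v ^ 3) * (i : ℚ) ^ 7 + (-36 * v ^ 2) * (i : ℚ) ^ 8 + (9 * v ^ 1) * (i : ℚ) ^ 9 + (-1 * v ^ 0) * (i : ℚ) ^ 10 := fun i => by ring
  simp only [h, Finset.sum_add_distrib, ← Finset.mul_sum, sum_Ico_pow_1 v hv, sum_Ico_pow_2 v hv, sum_Ico_pow_3 v hv, sum_Ico_pow_4 v hv, sum_Ico_pow_5 v hv, sum_Ico_pow_6 v hv, sum_Ico_pow_7 v hv, sum_Ico_pow_8 v hv, sum_Ico_pow_9 v hv, sum_Ico_pow_10 v hv]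
  ring

theorem stuffle_1_9 (n : ℕ) : divisorSumConv 1 9 n = doubleDivisorSum 1 9 n + doubleDivisorSum 9 1 n +
    ((1/110) * divisorSum 11 n - (1/12) * divisorSum 9 n + (3/10) * divisorSum 7 n - (1/2) * divisorSum 5 n + (7/20) * divisorSum 3 n - (5/66) * divisorSum 1 n) := by
  rw [divisorSumConv_stuffle]
  congr 1
  simp only [divisorSum_eq_sum_divisorsAntidiagonal, Finset.mul_sum, ← Finset.sum_add_distrib,
    ← Finset.sum_sub_distrib]
  refine Finset.sum_congr rfl fun x hx => ?_
  obtain ⟨rfl, h0⟩ := Nat.mem_divisorsAntidiagonal.1 hx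
  rw [sum_Ico_pow_1_mul_pow_9 _ (Nat.pos_of_ne_zero fun h => h0 (by simp [h]))]

theorem shuffle_1_9 (n : ℕ) : divisorSumConv 1 9 n =
    1 * doubleDivisorSum 1 9 n + 9 * doubleDivisorSum 2 8 n + 36 * doubleDivisorSum 3 7 n + 84 * doubleDivisorSum 4 6 n + 126 * doubleDivisorSum 5 5 n + 126 * doubleDivisorSum 6 4 n + 84 * doubleDivisorSum 7 3 n + 36 * doubleDivisorSum 8 2 n + 10 * doubleDivisorSum 9 1 n + 2 * doubleDivisorSum 10 0 n +
    (n * divisorSum 9 n - divisorSum 10 n) := by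
  rw [divisorSumConv_shuffle 1 9 n 9 rfl]
  simp [Finset.sum_range_succ, Nat.choose]
  ring

theorem sum_Ico_pow_2_mul_pow_8 (v : ℕ) (hv : 1 ≤ v) :
    ∑ i ∈ Finset.Ico 1 v, (i : ℚ) ^ 2 * ((v : ℚ) - i) ^ 8 =
      (1/495) * (v : ℚ) ^ 11 - (1/15) * (v : ℚ) ^ 7 + (2/9) * (v : ℚ) ^ 5 - (7/30) * (v : ℚ) ^ 3 + (5/66) * (v : ℚ) ^ 1 := by
  have h : ∀ i : ℕ, (i : ℚ) ^ 2 * ((v : ℚ) - i) ^ 8 =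
      (1 * v ^ 8) * (i : ℚ) ^ 2 + (-8 * v ^ 7) * (i : ℚ) ^ 3 + (28 * v ^ 6) * (i : ℚ) ^ 4 + (-56 * v ^ 5) * (i : ℚ) ^ 5 + (70 * v ^ 4) * (i : ℚ) ^ 6 + (-56 * v ^ 3) * (i : ℚ) ^ 7 + (28 * v ^ 2) * (i : ℚ) ^ 8 + (-8 * v ^ 1) * (i : ℚ) ^ 9 + (1 * v ^ 0) * (i : ℚ) ^ 10 := fun i => by ring
  simp only [h, Finset.sum_add_distrib, ← Finset.mul_sum, sum_Ico_pow_2 v hv, sum_Ico_pow_3 v hv, sum_Ico_pow_4 v hv, sum_Ico_pow_5 v hv, sum_Ico_pow_6 v hv, sum_Ico_pow_7 v hv, sum_Ico_pow_8 v hv, sum_Ico_pow_9 v hv, sum_Ico_pow_10 v hv]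
  ring

theorem stuffle_2_8 (n : ℕ) : divisorSumConv 2 8 n = doubleDivisorSum 2 8 n + doubleDivisorSum 8 2 n +
    ((1/495) * divisorSum 11 n - (1/15) * divisorSum 7 n + (2/9) * divisorSum 5 n - (7/30) * divisorSum 3 n + (5/66) * divisorSum 1 n) := by
  rw [divisorSumConv_stuffle]
  congr 1
  simp only [divisorSum_eq_sum_divisorsAntidiagonal, Finset.mul_sum, ← Finset.sum_add_distrib,
    ← Finset.sum_sub_distrib]
  refine Finset.sum_congr rfl fun x hx => ?_
  obtain ⟨rfl, h0⟩ := Nat.mem_divisorsAntidiagonal.1 hx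
  rw [sum_Ico_pow_2_mul_pow_8 _ (Nat.pos_of_ne_zero fun h => h0 (by simp [h]))]

theorem shuffle_2_8 (n : ℕ) : divisorSumConv 2 8 n =
    1 * doubleDivisorSum 2 8 n + 8 * doubleDivisorSum 3 7 n + 28 * doubleDivisorSum 4 6 n + 56 * doubleDivisorSum 5 5 n + 70 * doubleDivisorSum 6 4 n + 56 * doubleDivisorSum 7 3 n + 29 * doubleDivisorSum 8 2 n + 10 * doubleDivisorSum 9 1 n + 2 * doubleDivisorSum 10 0 n +
    (n * divisorSum 9 n - divisorSum 10 n) := by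
  rw [divisorSumConv_shuffle 2 8 n 9 rfl]
  simp [Finset.sum_range_succ, Nat.choose]
  ring

theorem sum_Ico_pow_3_mul_pow_7 (v : ℕ) (hv : 1 ≤ v) :
    ∑ i ∈ Finset.Ico 1 v, (i : ℚ) ^ 3 * ((v : ℚ) - i) ^ 7 =
      (1/1320) * (v : ℚ) ^ 11 + (1/120) * (v : ℚ) ^ 7 - (1/12) * (v : ℚ) ^ 5 + (3/20) * (v : ℚ) ^ 3 - (5/66) * (v : ℚ) ^ 1 := by
  have h : ∀ i : ℕ, (i : ℚ) ^ 3 * ((v : ℚ) - i) ^ 7 =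
      (1 * v ^ 7) * (i : ℚ) ^ 3 + (-7 * v ^ 6) * (i : ℚ) ^ 4 + (21 * v ^ 5) * (i : ℚ) ^ 5 + (-35 * v ^ 4) * (i : ℚ) ^ 6 + (35 * v ^ 3) * (i : ℚ) ^ 7 + (-21 * v ^ 2) * (i : ℚ) ^ 8 + (7 * v ^ 1) * (i : ℚ) ^ 9 + (-1 * v ^ 0) * (i : ℚ) ^ 10 := fun i => by ring
  simp only [h, Finset.sum_add_distrib, ← Finset.mul_sum, sum_Ico_pow_3 v hv, sum_Ico_pow_4 v hv, sum_Ico_pow_5 v hv, sum_Ico_pow_6 v hv, sum_Ico_pow_7 v hv, sum_Ico_pow_8 v hv, sum_Ico_pow_9 v hv, sum_Ico_pow_10 v hv]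
  ring

theorem stuffle_3_7 (n : ℕ) : divisorSumConv 3 7 n = doubleDivisorSum 3 7 n + doubleDivisorSum 7 3 n +
    ((1/1320) * divisorSum 11 n + (1/120) * divisorSum 7 n - (1/12) * divisorSum 5 n + (3/20) * divisorSum 3 n - (5/66) * divisorSum 1 n) := by
  rw [divisorSumConv_stuffle]
  congr 1
  simp only [divisorSum_eq_sum_divisorsAntidiagonal, Finset.mul_sum, ← Finset.sum_add_distrib,
    ← Finset.sum_sub_distrib]
  refine Finset.sum_congr rfl fun x hx => ?_
  obtain ⟨rfl, h0⟩ := Nat.mem_divisorsAntidiagonal.1 hx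
  rw [sum_Ico_pow_3_mul_pow_7 _ (Nat.pos_of_ne_zero fun h => h0 (by simp [h]))]

theorem shuffle_3_7 (n : ℕ) : divisorSumConv 3 7 n =
    1 * doubleDivisorSum 3 7 n + 7 * doubleDivisorSum 4 6 n + 21 * doubleDivisorSum 5 5 n + 35 * doubleDivisorSum 6 4 n + 36 * doubleDivisorSum 7 3 n + 24 * doubleDivisorSum 8 2 n + 10 * doubleDivisorSum 9 1 n + 2 * doubleDivisorSum 10 0 n +
    (n * divisorSum 9 n - divisorSum 10 n) := by
  rw [divisorSumConv_shuffle 3 7 n 9 rfl]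
  simp [Finset.sum_range_succ, Nat.choose]
  ring

theorem sum_Ico_pow_4_mul_pow_6 (v : ℕ) (hv : 1 ≤ v) :
    ∑ i ∈ Finset.Ico 1 v, (i : ℚ) ^ 4 * ((v : ℚ) - i) ^ 6 =
      (1/2310) * (v : ℚ) ^ 11 + (1/42) * (v : ℚ) ^ 5 - (1/10) * (v : ℚ) ^ 3 + (5/66) * (v : ℚ) ^ 1 := by
  have h : ∀ i : ℕ, (i : ℚ) ^ 4 * ((v : ℚ) - i) ^ 6 =
      (1 * v ^ 6) * (i : ℚ) ^ 4 + (-6 * v ^ 5) * (i : ℚ) ^ 5 + (15 * v ^ 4) * (i : ℚ) ^ 6 + (-20 * v ^ 3) * (i : ℚ) ^ 7 + (15 * v ^ 2) * (i : ℚ) ^ 8 + (-6 * v ^ 1) * (i : ℚ) ^ 9 + (1 * v ^ 0) * (i : ℚ) ^ 10 := fun i => by ring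
  simp only [h, Finset.sum_add_distrib, ← Finset.mul_sum, sum_Ico_pow_4 v hv, sum_Ico_pow_5 v hv, sum_Ico_pow_6 v hv, sum_Ico_pow_7 v hv, sum_Ico_pow_8 v hv, sum_Ico_pow_9 v hv, sum_Ico_pow_10 v hv]
  ring

theorem stuffle_4_6 (n : ℕ) : divisorSumConv 4 6 n = doubleDivisorSum 4 6 n + doubleDivisorSum 6 4 n +
    ((1/2310) * divisorSum 11 n + (1/42) * divisorSum 5 n - (1/10) * divisorSum 3 n + (5/66) * divisorSum 1 n) := by
  rw [divisorSumConv_stuffle]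
  congr 1
  simp only [divisorSum_eq_sum_divisorsAntidiagonal, Finset.mul_sum, ← Finset.sum_add_distrib,
    ← Finset.sum_sub_distrib]
  refine Finset.sum_congr rfl fun x hx => ?_
  obtain ⟨rfl, h0⟩ := Nat.mem_divisorsAntidiagonal.1 hx
  rw [sum_Ico_pow_4_mul_pow_6 _ (Nat.pos_of_ne_zero fun h => h0 (by simp [h]))]

theorem shuffle_4_6 (n : ℕ) : divisorSumConv 4 6 n =
    1 * doubleDivisorSum 4 6 n + 6 * doubleDivisorSum 5 5 n + 16 * doubleDivisorSum 6 4 n + 24 * doubleDivisorSum 7 3 n + 21 * doubleDivisorSum 8 2 n + 10 * doubleDivisorSum 9 1 n + 2 * doubleDivisorSum 10 0 n +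
    (n * divisorSum 9 n - divisorSum 10 n) := by
  rw [divisorSumConv_shuffle 4 6 n 9 rfl]
  simp [Finset.sum_range_succ, Nat.choose]
  ring

theorem sum_Ico_pow_5_mul_pow_5 (v : ℕ) (hv : 1 ≤ v) :
    ∑ i ∈ Finset.Ico 1 v, (i : ℚ) ^ 5 * ((v : ℚ) - i) ^ 5 =
      (1/2772) * (v : ℚ) ^ 11 - (1/126) * (v : ℚ) ^ 5 + (1/12) * (v : ℚ) ^ 3 - (5/66) * (v : ℚ) ^ 1 := by
  have h : ∀ i : ℕ, (i : ℚ) ^ 5 * ((v : ℚ) - i) ^ 5 =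
      (1 * v ^ 5) * (i : ℚ) ^ 5 + (-5 * v ^ 4) * (i : ℚ) ^ 6 + (10 * v ^ 3) * (i : ℚ) ^ 7 + (-10 * v ^ 2) * (i : ℚ) ^ 8 + (5 * v ^ 1) * (i : ℚ) ^ 9 + (-1 * v ^ 0) * (i : ℚ) ^ 10 := fun i => by ring
  simp only [h, Finset.sum_add_distrib, ← Finset.mul_sum, sum_Ico_pow_5 v hv, sum_Ico_pow_6 v hv, sum_Ico_pow_7 v hv, sum_Ico_pow_8 v hv, sum_Ico_pow_9 v hv, sum_Ico_pow_10 v hv]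
  ring

theorem stuffle_5_5 (n : ℕ) : divisorSumConv 5 5 n = doubleDivisorSum 5 5 n + doubleDivisorSum 5 5 n +
    ((1/2772) * divisorSum 11 n - (1/126) * divisorSum 5 n + (1/12) * divisorSum 3 n - (5/66) * divisorSum 1 n) := by
  rw [divisorSumConv_stuffle]
  congr 1
  simp only [divisorSum_eq_sum_divisorsAntidiagonal, Finset.mul_sum, ← Finset.sum_add_distrib,
    ← Finset.sum_sub_distrib]
  refine Finset.sum_congr rfl fun x hx => ?_
  obtain ⟨rfl, h0⟩ := Nat.mem_divisorsAntidiagonal.1 hx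
  rw [sum_Ico_pow_5_mul_pow_5 _ (Nat.pos_of_ne_zero fun h => h0 (by simp [h]))]

theorem shuffle_5_5 (n : ℕ) : divisorSumConv 5 5 n =
    2 * doubleDivisorSum 5 5 n + 10 * doubleDivisorSum 6 4 n + 20 * doubleDivisorSum 7 3 n + 20 * doubleDivisorSum 8 2 n + 10 * doubleDivisorSum 9 1 n + 2 * doubleDivisorSum 10 0 n +
    (n * divisorSum 9 n - divisorSum 10 n) := by
  rw [divisorSumConv_shuffle 5 5 n 9 rfl]
  simp [Finset.sum_range_succ, Nat.choose]
  ring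

/-! ### The q-expansion of the discriminant -/

section
open UpperHalfPlane ModularForm ModularFormClass EisensteinSeries MatrixGroups

/-- By the Sturm bound a form of weight 8 and level one vanishes as soon as its constant term does,
and both sides have constant term 1. -/
theorem qExpansion_E_four_mul_self :
    qExpansion 1 E₄ * qExpansion 1 E₄ = qExpansion 1 (E (k := 8) (by norm_num)) := by
  set f : ModularForm 𝒮ℒ ((8 : ℕ) : ℤ) :=
    ModularForm.mcast (by decide) (E₄.mul E₄) - E (k := 8) (by norm_num) with hf
  have hq : qExpansion 1 f =
      qExpansion 1 E₄ * qExpansion 1 E₄ - qExpansion 1 (E (k := 8) (by norm_num)) := by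
    simp only [hf, FunLike.coe_sub, coe_mcast,
      ModularForm.qExpansion_sub one_pos one_mem_strictPeriods_SL,
      ModularForm.qExpansion_mul one_pos one_mem_strictPeriods_SL]
  have h0 : f = 0 := by
    refine sturm_bound_levelOne_nat (k := 8) ?_
    rw [hq]
    refine lt_of_lt_of_le (b := ((1 : ℕ) : ℕ∞)) (by norm_num) (PowerSeries.nat_le_order _ _ ?_)
    intro i hi
    obtain rfl : i = 0 := by omega
    simp [PowerSeries.coeff_mul, -PowerSeries.coeff_zero_eq_constantCoeff,
      E_qExpansion_coeff_zero _ ⟨2, rfl⟩, E_qExpansion_coeff_zero _ ⟨4, rfl⟩]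
  rw [h0] at hq
  exact sub_eq_zero.1 (hq.symm.trans (by simpa using qExpansion_zero 1))

/-- Replacing E₄³ by E₄E₈ leaves products of only two Eisenstein series, hence only convolutions of
two divisor sums. -/
theorem qExpansion_discriminant_eq :
    (1728 : ℂ) • qExpansion 1 (CuspForm.discriminant : ℍ → ℂ) =
      qExpansion 1 E₄ * qExpansion 1 (E (k := 8) (by norm_num)) -
        qExpansion 1 E₆ * qExpansion 1 E₆ := by
  set f : ModularForm 𝒮ℒ 12 :=
    ModularForm.mcast (by decide) (E₄.pow 3) - ModularForm.mcast (by decide) (E₆.pow 2) with hf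
  have hq : qExpansion 1 f = qExpansion 1 E₄ * (qExpansion 1 E₄ * qExpansion 1 E₄) -
      qExpansion 1 E₆ * qExpansion 1 E₆ := by
    simp only [hf, FunLike.coe_sub, coe_mcast,
      ModularForm.qExpansion_sub one_pos one_mem_strictPeriods_SL,
      ModularForm.qExpansion_pow one_pos one_mem_strictPeriods_SL]
    ring
  have hΔ : (CuspForm.discriminant : ℍ → ℂ) = ((1728 : ℂ)⁻¹ • f : ModularForm 𝒮ℒ 12) := by
    funext z
    rw [CuspForm.coe_discriminant, discriminant_eq_E₄_cube_sub_E₆_sq]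
    simp only [hf, FunLike.coe_smul, Pi.smul_apply, FunLike.coe_sub, coe_mcast, ModularForm.coe_pow, Pi.sub_apply,
      Pi.pow_apply, smul_eq_mul]
    ring
  rw [hΔ, FunLike.coe_smul, ModularForm.qExpansion_smul one_pos one_mem_strictPeriods_SL, smul_smul, hq,
    qExpansion_E_four_mul_self]
  simp

theorem coeff_mk_mul_mk_divisorSum (r s n : ℕ) :
    coeff n (PowerSeries.mk (divisorSum r) * PowerSeries.mk (divisorSum s)) =
      divisorSumConv r s n := by
  simp only [coeff_mul, coeff_mk, divisorSumConv]

/-- The coefficients of the discriminant as combinations of divisor sums. -/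
def discriminantCoeff (n : ℕ) : ℚ :=
  (240 * divisorSum 3 n + 480 * divisorSum 7 n + 1008 * divisorSum 5 n +
    115200 * divisorSumConv 3 7 n - 254016 * divisorSumConv 5 5 n) / 1728

theorem qExpansion_E_eq {k : ℕ} (hk : 3 ≤ k) (hk2 : Even k) (c : ℚ)
    (hc : c = -(2 * k / bernoulli k)) :
    qExpansion 1 (E hk) =
      (1 + C c * PowerSeries.mk (divisorSum (k - 1)) : ℚ⟦X⟧).map (algebraMap ℚ ℂ) := by
  ext n
  rw [E_qExpansion_coeff hk hk2, coeff_map, hc]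
  simp only [map_add, coeff_C_mul, coeff_mk, coeff_one, divisorSum]
  split_ifs with h
  · simp [h]
  · simp

theorem qExpansion_discriminant :
    qExpansion 1 (CuspForm.discriminant : ℍ → ℂ) =
      (PowerSeries.mk discriminantCoeff).map (algebraMap ℚ ℂ) := by
  have h := qExpansion_discriminant_eq
  rw [qExpansion_E_eq _ ⟨2, rfl⟩ 240 (by rw [show bernoulli 4 = -1 / 30 by decide +kernel]; norm_num),
    qExpansion_E_eq _ ⟨3, rfl⟩ (-504) (by rw [show bernoulli 6 = 1 / 42 by decide +kernel]; norm_num),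
    qExpansion_E_eq _ ⟨4, rfl⟩ 480 (by rw [show bernoulli 8 = -1 / 30 by decide +kernel]; norm_num),
    ← map_mul, ← map_mul, ← map_sub] at h
  have h1728 : (1728 : ℂ) ≠ 0 := by norm_num
  ext n
  apply mul_left_cancel₀ h1728
  have hn := congrArg (coeff n) h
  rw [coeff_smul, smul_eq_mul] at hn
  rw [hn, coeff_map, coeff_map, coeff_mk, discriminantCoeff]
  have key : (1 + C (240 : ℚ) * PowerSeries.mk (divisorSum 3)) *
      (1 + C (480 : ℚ) * PowerSeries.mk (divisorSum 7)) -
      (1 + C (-504 : ℚ) * PowerSeries.mk (divisorSum 5)) *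
      (1 + C (-504 : ℚ) * PowerSeries.mk (divisorSum 5)) =
      C 240 * PowerSeries.mk (divisorSum 3) + C 480 * PowerSeries.mk (divisorSum 7) +
      C 1008 * PowerSeries.mk (divisorSum 5) +
      C 115200 * (PowerSeries.mk (divisorSum 3) * PowerSeries.mk (divisorSum 7)) -
      C 254016 * (PowerSeries.mk (divisorSum 5) * PowerSeries.mk (divisorSum 5)) := by
    simp only [show (115200 : ℚ) = 240 * 480 by norm_num, show (1008 : ℚ) = 504 + 504 by norm_num,
      show (254016 : ℚ) = 504 * 504 by norm_num, map_mul, map_add, map_neg]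
    ring
  rw [key]
  simp only [map_sub, map_add, coeff_C_mul, coeff_mk, coeff_mk_mul_mk_divisorSum, eq_ratCast]
  push_cast
  ring

end

/-! ### Pairings with divisor sums in a form suited to kernel evaluation -/

/-- `∑ k < n, f k`, in a form that evaluates well. -/
def sumTo (n : ℕ) (f : ℕ → ℕ) : ℕ := Nat.rec 0 (fun k ih => ih + f k) n

theorem sumTo_eq_sum (n : ℕ) (f : ℕ → ℕ) : sumTo n f = ∑ k ∈ Finset.range n, f k := by
  induction n with
  | zero => rfl
  | succ n ih => rw [Finset.sum_range_succ, ← ih]; rfl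

/-- `∀ k < n, f k`, in a form that evaluates well. -/
def allTo (n : ℕ) (f : ℕ → Bool) : Bool := Nat.rec true (fun k ih => ih && f k) n

theorem allTo_eq_true {n : ℕ} {f : ℕ → Bool} (h : allTo n f = true) {k : ℕ} (hk : k < n) :
    f k = true := by
  induction n with
  | zero => omega
  | succ n ih =>
    have h' : (allTo n f && f n) = true := h
    rw [Bool.and_eq_true] at h'
    rcases Nat.lt_succ_iff_lt_or_eq.1 hk with hk | rfl
    · exact ih h'.1 hk
    · exact h'.2

/-- The `n`-th digit of `L` in base `2 ^ 32`. -/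
def digit (L n : ℕ) : ℕ := L >>> (32 * n) % 4294967296

/-- The sum of the digits of `L` at `u₁ v₁ + u₂ v₂ ≤ 53`, over all `u₁ > u₂ > 0`. -/
def pairWeight (L v₁ v₂ : ℕ) : ℕ :=
  sumTo (53 / (v₁ + v₂)) fun w => sumTo ((53 - (w + 1) * (v₁ + v₂)) / v₁) fun k =>
    digit L ((w + 1) * (v₁ + v₂) + (k + 1) * v₁)

/-- The inner sum of `pairMoment`. -/
def pairMomentAux (L s v₁ : ℕ) : ℕ :=
  sumTo (53 - 2 * (v₁ + 1)) fun v₂ => (v₂ + 1) ^ s * pairWeight L (v₁ + 1) (v₂ + 1)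

/-- The pairing of the digits of `L` with the double divisor sums. -/
def pairMoment (L r s : ℕ) : ℕ := sumTo 26 fun v₁ => (v₁ + 1) ^ r * pairMomentAux L s v₁

/-- The pairing of the digits of `L` with the divisor sums. -/
def moment (L r : ℕ) : ℕ :=
  sumTo 53 fun v => (v + 1) ^ r * sumTo (53 / (v + 1)) fun u => digit L ((u + 1) * (v + 1))

-- Sum over v first and then over its multiples uv ≤ 53; the term n = 0 contributes nothing because
-- σ_r(0) = 0.
set_option linter.constructorNameAsVariable false in
theorem moment_eq (L r : ℕ) :
    moment L r = ∑ n ∈ Finset.range 54, digit L n * ArithmeticFunction.sigma r n := by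
  simp only [moment, sumTo_eq_sum, Finset.mul_sum, ArithmeticFunction.sigma_apply,
    ← Nat.sum_divisorsAntidiagonal' (fun _ d => d ^ r)]
  rw [Finset.sum_sigma', Finset.sum_sigma']
  refine Finset.sum_nbij' (fun x => ⟨(x.2 + 1) * (x.1 + 1), (x.2 + 1, x.1 + 1)⟩)
    (fun x => ⟨x.2.2 - 1, x.2.1 - 1⟩) ?_ ?_ ?_ ?_ ?_
  · rintro ⟨v, u⟩ h
    simp only [Finset.mem_sigma, Finset.mem_range, Nat.mem_divisorsAntidiagonal] at h ⊢
    have := (Nat.le_div_iff_mul_le (Nat.succ_pos v)).1 (Nat.succ_le_of_lt h.2)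
    exact ⟨by simpa using Nat.lt_succ_of_le this, trivial, by positivity⟩
  · rintro ⟨n, u, v⟩ h
    simp only [Finset.mem_sigma, Finset.mem_range, Nat.mem_divisorsAntidiagonal] at h ⊢
    obtain ⟨h1, rfl, h2⟩ := h
    obtain ⟨hu, hv⟩ := Nat.mul_ne_zero_iff.1 h2
    obtain ⟨u, rfl⟩ := Nat.exists_eq_succ_of_ne_zero hu
    obtain ⟨v, rfl⟩ := Nat.exists_eq_succ_of_ne_zero hv
    simp only [Nat.succ_eq_add_one, Nat.add_sub_cancel] at h1 ⊢
    refine ⟨by nlinarith, ?_⟩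
    rw [← Nat.succ_le_iff, Nat.le_div_iff_mul_le (by omega)]
    exact Nat.lt_succ_iff.1 h1
  · rintro ⟨v, u⟩ -
    rfl
  · rintro ⟨n, u, v⟩ h
    simp only [Finset.mem_sigma, Finset.mem_range, Nat.mem_divisorsAntidiagonal] at h
    obtain ⟨h1, rfl, h2⟩ := h
    obtain ⟨hu, hv⟩ := Nat.mul_ne_zero_iff.1 h2
    obtain ⟨u, rfl⟩ := Nat.exists_eq_succ_of_ne_zero hu
    obtain ⟨v, rfl⟩ := Nat.exists_eq_succ_of_ne_zero hv
    rfl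
  · rintro ⟨v, u⟩ -
    exact mul_comm _ _

-- Substitute u₂ = w + 1 and u₁ − u₂ = k + 1, and write u₁v₁ + u₂v₂ = u₂(v₁ + v₂) + (u₁ − u₂)v₁. The
-- bounds 26 and 53 − 2v₁ come from 2v₁ + v₂ ≤ 53, which holds since u₁ ≥ 2 and u₂ ≥ 1.
set_option linter.constructorNameAsVariable false in
theorem pairMoment_eq (L r s : ℕ) :
    pairMoment L r s = ∑ n ∈ Finset.range 54, digit L n * multipleDivisorSum [r, s] n := by
  simp only [pairMoment, pairMomentAux, pairWeight, sumTo_eq_sum, Finset.mul_sum,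
    multipleDivisorSum_pair]
  simp only [Finset.sum_sigma']
  refine Finset.sum_nbij' (fun x => ⟨(x.2.2.1 + 1) * (x.1 + 1 + (x.2.1 + 1)) +
      (x.2.2.2 + 1) * (x.1 + 1), ((x.2.2.1 + 1 + x.2.2.2 + 1, x.1 + 1), (x.2.2.1 + 1, x.2.1 + 1))⟩)
    (fun x => ⟨x.2.1.2 - 1, x.2.2.2 - 1, x.2.2.1 - 1, x.2.1.1 - x.2.2.1 - 1⟩) ?_ ?_ ?_ ?_ ?_
  · rintro ⟨v₁, v₂, w, k⟩ h
    simp only [Finset.mem_sigma, Finset.mem_range, decreasingQuadruples, Finset.mem_filter,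
      mem_quadruples] at h ⊢
    obtain ⟨h1, h2, h3, h4⟩ := h
    have h5 := (Nat.le_div_iff_mul_le (Nat.succ_pos v₁)).1 (Nat.succ_le_of_lt h4)
    have h6 := (Nat.le_div_iff_mul_le (by omega)).1 (Nat.succ_le_of_lt h3)
    simp only [Nat.succ_eq_add_one] at h5 h6
    exact ⟨by omega, ⟨by omega, by ring⟩, by omega⟩
  · rintro ⟨n, ⟨u₁, v₁⟩, u₂, v₂⟩ h
    simp only [Finset.mem_sigma, Finset.mem_range, decreasingQuadruples, Finset.mem_filter,
      mem_quadruples] at h ⊢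
    obtain ⟨h1, ⟨⟨h2, h3, h4, h5⟩, rfl⟩, h6⟩ := h
    obtain ⟨k, rfl⟩ := Nat.exists_eq_add_of_lt h6
    obtain ⟨v₁, rfl⟩ := Nat.exists_eq_succ_of_ne_zero h3.ne'
    obtain ⟨v₂, rfl⟩ := Nat.exists_eq_succ_of_ne_zero h5.ne'
    obtain ⟨u₂, rfl⟩ := Nat.exists_eq_succ_of_ne_zero h4.ne'
    simp only [Nat.succ_eq_add_one, Nat.add_sub_cancel] at h1 ⊢
    rw [show u₂ + 1 + k + 1 - (u₂ + 1) - 1 = k by omega]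
    have h7 : (u₂ + 1) * (v₁ + 1 + (v₂ + 1)) + (k + 1) * (v₁ + 1) ≤ 53 := by
      nlinarith
    have h8 : 2 * (v₁ + 1) + (v₂ + 1) ≤ 53 := by nlinarith
    refine ⟨by omega, by omega, ?_, ?_⟩
    · rw [← Nat.succ_le_iff, Nat.le_div_iff_mul_le (by omega)]
      exact le_trans (Nat.le_add_right _ _) h7
    · rw [← Nat.succ_le_iff, Nat.le_div_iff_mul_le (by omega)]
      exact Nat.le_sub_of_add_le (by linarith)
  · rintro ⟨v₁, v₂, w, k⟩ -
    have : w + 1 + k + 1 - (w + 1) - 1 = k := by omega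
    simp only [Nat.add_sub_cancel, this]
  · rintro ⟨n, ⟨u₁, v₁⟩, u₂, v₂⟩ h
    simp only [Finset.mem_sigma, Finset.mem_range, decreasingQuadruples, Finset.mem_filter,
      mem_quadruples] at h ⊢
    obtain ⟨h1, ⟨⟨h2, h3, h4, h5⟩, rfl⟩, h6⟩ := h
    obtain ⟨k, rfl⟩ := Nat.exists_eq_add_of_lt h6
    obtain ⟨v₁, rfl⟩ := Nat.exists_eq_succ_of_ne_zero h3.ne'
    obtain ⟨v₂, rfl⟩ := Nat.exists_eq_succ_of_ne_zero h5.ne'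
    obtain ⟨u₂, rfl⟩ := Nat.exists_eq_succ_of_ne_zero h4.ne'
    have : u₂ + 1 + k + 1 - (u₂ + 1) - 1 = k := by omega
    simp only [Nat.succ_eq_add_one, Nat.add_sub_cancel, this]
    congr 1
    ring
  · rintro ⟨v₁, v₂, w, k⟩ -
    ring

/-! ### Linear functionals that see only weight twelve -/

theorem coeff_bracket_singleton (a : ℕ+) (n : ℕ) :
    coeff n (bracket [a]) = divisorSum ((a : ℕ) - 1) n / (((a : ℕ) - 1).factorial : ℚ) := by
  simp only [bracket, coeff_mk, List.map_cons, List.map_nil, multipleDivisorSum_singleton,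
    List.prod_cons, List.prod_nil, mul_one, divisorSum]

theorem coeff_bracket_pair (a b : ℕ+) (n : ℕ) :
    coeff n (bracket [a, b]) = doubleDivisorSum ((a : ℕ) - 1) ((b : ℕ) - 1) n /
      ((((a : ℕ) - 1).factorial : ℚ) * (((b : ℕ) - 1).factorial : ℚ)) := by
  simp only [bracket, coeff_mk, List.map_cons, List.map_nil, List.prod_cons, List.prod_nil, mul_one,
    doubleDivisorSum]

theorem coeff_bracket_nil {n : ℕ} (hn : n ≠ 0) : coeff n (bracket []) = 0 := by
  simp only [bracket, coeff_mk, List.map_nil, multipleDivisorSum_nil hn, Nat.cast_zero, zero_div]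

theorem coeff_evalBrackets (d : List ℕ+ →₀ ℚ) (n : ℕ) :
    coeff n (evalBrackets d) = d.sum fun s x => x * coeff n (bracket s) := by
  simp only [evalBrackets, Finsupp.linearCombination_apply, Finsupp.sum, map_sum, coeff_smul,
    smul_eq_mul]

/-- The index `(r + 1, 11 - r)` of weight twelve. -/
def pairIndex (r : ℕ) : List ℕ+ := [r.succPNat, (10 - r).succPNat]

theorem pairIndex_injective : Function.Injective pairIndex := by
  intro r s h
  simpa using (List.cons.inj h).1

theorem pairIndex_ne_singleton (r : ℕ) (a : ℕ+) : pairIndex r ≠ [a] := by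
  simp [pairIndex]

theorem eq_pairIndex {a b : ℕ+} (h : (a : ℕ) + b = 12) :
    ((a : ℕ) - 1) < 11 ∧ [a, b] = pairIndex ((a : ℕ) - 1) := by
  have ha := a.pos
  have hb := b.pos
  refine ⟨by omega, ?_⟩
  simp only [pairIndex, List.cons.injEq, and_true]
  refine ⟨PNat.eq ?_, PNat.eq ?_⟩ <;> simp only [Nat.succPNat_coe, Nat.succ_eq_add_one] <;> omega

theorem mem_pairIndices_iff {s : List ℕ+} :
    s ∈ pairIndices 12 ↔ ∃ r < 11, s = pairIndex r := by
  constructor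
  · rintro ⟨h1, h2⟩
    obtain ⟨a, b, rfl⟩ := List.length_eq_two.1 h2
    simp only [indexWeight, List.map_cons, List.map_nil, List.sum_cons, List.sum_nil,
      add_zero] at h1
    exact ⟨_, eq_pairIndex h1⟩
  · rintro ⟨r, hr, rfl⟩
    refine ⟨?_, rfl⟩
    change r + 1 + (10 - r + 1 + 0) = 12
    omega

/-- The indices of weight twelve and length one or two. -/
def topIndices : Finset (List ℕ+) := insert [12] ((Finset.range 11).image pairIndex)

theorem mem_topIndices {s : List ℕ+} : s ∈ topIndices ↔ s = [12] ∨ ∃ r < 11, s = pairIndex r := by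
  simp only [topIndices, Finset.mem_insert, Finset.mem_image, Finset.mem_range, eq_comm]

theorem sum_topIndices (f : List ℕ+ → ℚ) :
    ∑ s ∈ topIndices, f s = f [12] + ∑ r ∈ Finset.range 11, f (pairIndex r) := by
  rw [topIndices, Finset.sum_insert, Finset.sum_image fun _ _ _ _ h => pairIndex_injective h]
  simp only [Finset.mem_image, not_exists, not_and]
  exact fun r _ => pairIndex_ne_singleton r 12

/-- The bounds concern the exponents sᵢ − 1, in the ranges through which `agreeBelow` runs. -/
theorem indicesUpTo_twelve {s : List ℕ+} (hs : s ∈ indicesUpTo 12 2) :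
    s = [] ∨ (∃ a : ℕ+, s = [a] ∧ (a : ℕ) - 1 ≤ 10) ∨
      (∃ a b : ℕ+, s = [a, b] ∧ ((a : ℕ) - 1) + ((b : ℕ) - 1) ≤ 9) ∨ s ∈ topIndices := by
  obtain ⟨h1, h2⟩ := hs
  match s with
  | [] => exact Or.inl rfl
  | [a] =>
    change (a : ℕ) ≤ 12 at h1
    rcases h1.lt_or_eq with h | h
    · exact Or.inr (Or.inl ⟨a, rfl, by omega⟩)
    · exact Or.inr (Or.inr (Or.inr (mem_topIndices.2 (Or.inl
        (congrArg (fun x => [x]) (PNat.eq h))))))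
  | [a, b] =>
    simp only [indexWeight, List.map_cons, List.map_nil, List.sum_cons, List.sum_nil,
      add_zero] at h1
    change (a : ℕ) + (b : ℕ) ≤ 12 at h1
    have ha := a.pos
    have hb := b.pos
    rcases h1.lt_or_eq with h | h
    · exact Or.inr (Or.inr (Or.inl ⟨a, b, rfl, by omega⟩))
    · exact Or.inr (Or.inr (Or.inr (mem_topIndices.2 (Or.inr ⟨_, eq_pairIndex h⟩))))
  | a :: b :: c :: l => simp at h2

/-- The linear functional on power series whose values at the `qⁿ` are the differences of the
digits of `L` and `M`. -/
noncomputable def digitFunctional (L M : ℕ) : ℚ⟦X⟧ →ₗ[ℚ] ℚ :=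
  ∑ n ∈ Finset.range 54, ((digit L n : ℚ) - digit M n) • coeff n

theorem digitFunctional_apply (L M : ℕ) (f : ℚ⟦X⟧) :
    digitFunctional L M f =
      ∑ n ∈ Finset.range 54, ((digit L n : ℚ) - digit M n) * coeff n f := by
  simp [digitFunctional, LinearMap.sum_apply]

theorem digitFunctional_bracket_singleton (L M : ℕ) (a : ℕ+) :
    digitFunctional L M (bracket [a]) =
      ((moment L ((a : ℕ) - 1) : ℚ) - moment M ((a : ℕ) - 1)) / (((a : ℕ) - 1).factorial : ℚ) := by
  simp only [digitFunctional_apply, coeff_bracket_singleton, moment_eq, divisorSum]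
  push_cast
  rw [← Finset.sum_sub_distrib, Finset.sum_div]
  exact Finset.sum_congr rfl fun n _ => by ring

theorem digitFunctional_bracket_pair (L M : ℕ) (a b : ℕ+) :
    digitFunctional L M (bracket [a, b]) =
      ((pairMoment L ((a : ℕ) - 1) ((b : ℕ) - 1) : ℚ) -
        pairMoment M ((a : ℕ) - 1) ((b : ℕ) - 1)) /
      ((((a : ℕ) - 1).factorial : ℚ) * (((b : ℕ) - 1).factorial : ℚ)) := by
  simp only [digitFunctional_apply, coeff_bracket_pair, pairMoment_eq, doubleDivisorSum]
  push_cast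
  rw [← Finset.sum_sub_distrib, Finset.sum_div]
  exact Finset.sum_congr rfl fun n _ => by ring

/-- The digits of `L` and `M` define the same functional on all brackets of weight at most eleven
and length at most two. -/
def agreeBelow (L M : ℕ) : Bool :=
  (digit L 0).beq (digit M 0) && ((allTo 11 fun r => (moment L r).beq (moment M r)) &&
    allTo 10 fun r => allTo (10 - r) fun s => (pairMoment L r s).beq (pairMoment M r s))

theorem digitFunctional_bracket_eq_zero {L M : ℕ} (h : agreeBelow L M = true) {s : List ℕ+}
    (hs : s ∈ indicesUpTo 12 2) (ht : s ∉ topIndices) :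
    digitFunctional L M (bracket s) = 0 := by
  simp only [agreeBelow, Bool.and_eq_true] at h
  obtain ⟨h0, h1, h2⟩ := h
  rcases indicesUpTo_twelve hs with rfl | ⟨a, rfl, ha⟩ | ⟨a, b, rfl, hab⟩ | h
  · rw [digitFunctional_apply]
    refine Finset.sum_eq_zero fun n _ => ?_
    rcases eq_or_ne n 0 with rfl | hn
    · rw [Nat.eq_of_beq_eq_true h0, sub_self, zero_mul]
    · rw [coeff_bracket_nil hn, mul_zero]
  · rw [digitFunctional_bracket_singleton,
      Nat.eq_of_beq_eq_true (allTo_eq_true h1 (Nat.lt_succ_of_le ha)), sub_self, zero_div]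
  · rw [digitFunctional_bracket_pair,
      Nat.eq_of_beq_eq_true (allTo_eq_true (allTo_eq_true h2 (by omega)) (by omega)), sub_self,
      zero_div]
  · exact absurd h ht

/-- A relation between brackets of weight at most twelve and length at most two satisfies a linear
equation that involves its coefficients of weight twelve only. -/
theorem linear_equation_of_agreeBelow {L M : ℕ} (h : agreeBelow L M = true) {d : List ℕ+ →₀ ℚ}
    (hd : evalBrackets d = 0) (hs : (d.support : Set (List ℕ+)) ⊆ indicesUpTo 12 2) :
    ((moment L 11 : ℚ) - moment M 11) * (d [12] / (11).factorial) +
      ∑ r ∈ Finset.range 11, ((pairMoment L r (10 - r) : ℚ) - pairMoment M r (10 - r)) *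
        (d (pairIndex r) / (r.factorial * (10 - r).factorial)) = 0 := by
  have h1 : ∑ s ∈ d.support, d s * digitFunctional L M (bracket s) = 0 := by
    have := congrArg (digitFunctional L M) hd
    simpa only [evalBrackets, Finsupp.linearCombination_apply, Finsupp.sum, map_sum, map_smul,
      smul_eq_mul, map_zero] using this
  -- Both sums equal the sum over the union of the two index sets: d vanishes off its support, and
  -- on the support the functional vanishes off `topIndices`.
  have h2 : ∑ s ∈ d.support, d s * digitFunctional L M (bracket s) =
      ∑ s ∈ topIndices, d s * digitFunctional L M (bracket s) := by
    rw [Finset.sum_subset (Finset.subset_union_left (s₂ := topIndices)) fun s _ h => by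
        rw [Finsupp.notMem_support_iff.1 h, zero_mul],
      ← Finset.sum_subset (Finset.subset_union_right (s₁ := d.support)) fun s h1 h2 => ?_]
    have h3 := (Finset.mem_union.1 h1).resolve_right h2
    rw [digitFunctional_bracket_eq_zero h (hs h3) h2, mul_zero]
  rw [h2, sum_topIndices, digitFunctional_bracket_singleton] at h1
  rw [← h1]
  congr 1
  · change _ = d [12] * (((moment L 11 : ℚ) - moment M 11) / ((11).factorial : ℚ))
    ring
  · refine Finset.sum_congr rfl fun r _ => ?_
    rw [pairIndex, digitFunctional_bracket_pair]
    simp only [Nat.succPNat_coe, Nat.succ_eq_add_one, Nat.add_sub_cancel]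
    ring

/-- The coefficient of `[r + 1, 11 - r]`, normalized by factorials, for `r ≤ 10`, and the
normalized coefficient of `[12]` for `r = 11`. -/
def normalizedCoeff (d : List ℕ+ →₀ ℚ) (r : ℕ) : ℚ :=
  if r = 11 then d [12] / (11).factorial
  else d (pairIndex r) / (r.factorial * (10 - r).factorial)

/-- `L` and `M` define the same functional on the brackets of weight at most eleven and length at
most two, and the values of the difference on brackets of weight twelve are listed in `v`. -/
def checkCertificate (L M : ℕ) (v : List ℤ) : Bool :=
  agreeBelow L M && (((moment L 11 : ℤ) == moment M 11 + v.getD 11 0) &&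
    allTo 11 fun r => (pairMoment L r (10 - r) : ℤ) == pairMoment M r (10 - r) + v.getD r 0)

theorem linear_equation_of_checkCertificate (L M : ℕ) (v : List ℤ)
    (h : checkCertificate L M v = true) {d : List ℕ+ →₀ ℚ} (hd : evalBrackets d = 0)
    (hs : (d.support : Set (List ℕ+)) ⊆ indicesUpTo 12 2) :
    ∑ r ∈ Finset.range 12, (v.getD r 0 : ℚ) * normalizedCoeff d r = 0 := by
  simp only [checkCertificate, Bool.and_eq_true, beq_iff_eq] at h
  obtain ⟨h0, h1, h2⟩ := h
  rw [← linear_equation_of_agreeBelow h0 hd hs, Finset.sum_range_succ, add_comm]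
  congr 1
  · rw [← Int.cast_natCast (moment L 11), h1]
    push_cast
    simp only [normalizedCoeff, if_true, add_sub_cancel_left]
  · refine Finset.sum_congr rfl fun r hr => ?_
    have hr' := Finset.mem_range.1 hr
    have h3 := allTo_eq_true h2 hr'
    rw [beq_iff_eq] at h3
    rw [← Int.cast_natCast (pairMoment L r (10 - r)), h3]
    push_cast
    rw [normalizedCoeff, if_neg hr'.ne, add_sub_cancel_left]

/-! ### Seven equations for the coefficients of weight twelve -/

/-- The two large numbers encode, as a difference of digit sequences, an integer vector orthogonal
to all lower brackets; two are needed because digits are nonnegative. The list contains its pairings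
with the double divisor sums of exponents (r, 10 − r) and with σ₁₁. The check is a finite integer
computation, and likewise for the six equations that follow. -/
theorem weight_twelve_equation_0 {d : List ℕ+ →₀ ℚ} (hd : evalBrackets d = 0)
    (hs : (d.support : Set (List ℕ+)) ⊆ indicesUpTo 12 2) :
    1641063351951072000 * normalizedCoeff d 0 + 29414832779324160 * normalizedCoeff d 1 +
    2105802316074240 * normalizedCoeff d 2 + 322325066931840 * normalizedCoeff d 3 +
    82388800270080 * normalizedCoeff d 4 + 32310828115200 * normalizedCoeff d 5 + 18849428213760
    * normalizedCoeff d 6 + 15671460994560 * normalizedCoeff d 7 + 21445244674560 *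
    normalizedCoeff d 8 + 38950902708480 * normalizedCoeff d 9 + (-8259634358841600) *
    normalizedCoeff d 10 + 5159290730001408000 * normalizedCoeff d 11 = 0 := by
  have h := linear_equation_of_checkCertificate
    150540369259052701604750145953669732373410495658758729133524048861112850023475547380442236954365665500548036299257598897555592067910113194658206655027710151859056677474946092392500141734959525597257473672001750697326099629280870170632302149435343710074595327027337323099613702660830426935706657585333169925764167841199842134645557531159213412249834026689121323069325687129630452455342226909463519478156438918502559932223382110425217819437411131024988142542460547054621548135778016125404890128483040905658368
    446749236994904233616522687746859210668855468333255315259531128765229619864779435467617062262682509435272417850197352891889268916240744652450216741742035607884715442089950260064524399768791270197360318277650115816485274658464307103395531924555438819294355991108069820256078778428765466548321312887890920889947952716014346160787155208394522685505696729654448350218982273967253950840691117608674141491758620970653465233591724164348523089683193206510624813691126657005623929184688588467075886133672445409792859771502592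
    [1641063351951072000, 29414832779324160, 2105802316074240, 322325066931840, 82388800270080,
    32310828115200, 18849428213760, 15671460994560, 21445244674560, 38950902708480,
    -8259634358841600, 5159290730001408000]
    (by decide +kernel) hd hs
  simpa only [Finset.sum_range_succ, Finset.sum_range_zero, zero_add, List.getD_cons_zero,
    List.getD_cons_succ, Int.cast_ofNat, Int.cast_neg] using h

theorem weight_twelve_equation_1 {d : List ℕ+ →₀ ℚ} (hd : evalBrackets d = 0)
    (hs : (d.support : Set (List ℕ+)) ⊆ indicesUpTo 12 2) :
    (-1649143651463884800) * normalizedCoeff d 0 + (-28126575745269120) * normalizedCoeff d 1 +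
    (-2006697867793920) * normalizedCoeff d 2 + (-306941914671840) * normalizedCoeff d 3 +
    (-78610163575680) * normalizedCoeff d 4 + (-30784445366400) * normalizedCoeff d 5 +
    (-17850905832960) * normalizedCoeff d 6 + (-15129271704960) * normalizedCoeff d 7 +
    (-20217089410560) * normalizedCoeff d 8 + (-36594802339200) * normalizedCoeff d 9 +
    6888157460352000 * normalizedCoeff d 10 + (-4916077933447296000) * normalizedCoeff d 11 = 0 := by
  have h := linear_equation_of_checkCertificate
    249644971474399927672537997636833334832242505857615702283324213940388292770124836808332940701392274832900166233118882977467705780937542435759538251255386036389089623276025664930858119977924954190131342231671073559437477674039899903315595105111300630291861920176872375651940872989974997411657678626198188819596010619019263164415488629039033815343333699499742073132532551810818428132097208329173502694711126746238032554984254919927726321622052849223063585394042552742510800722998751698899312641637464474133568887455744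
    149390467364300308736533638944833627285404380876993724377613965041009494896112222183251322284227624522554397835583866507374451264093748262560049957635014502000322005656670477185084389199217478868957611638486042092706261656031947743904805754708271575019722697732790470160192268704858507725591174614861147329020947814653719776376084992033994199299907262615903213517773883136710904972433375005697713589966142702740243243797691972661456215625920575123182214265800564126299281442452317082053681929912383417876480
    [-1649143651463884800, -28126575745269120, -2006697867793920, -306941914671840,
    -78610163575680, -30784445366400, -17850905832960, -15129271704960, -20217089410560,
    -36594802339200, 6888157460352000, -4916077933447296000]
    (by decide +kernel) hd hs
  simpa only [Finset.sum_range_succ, Finset.sum_range_zero, zero_add, List.getD_cons_zero,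
    List.getD_cons_succ, Int.cast_ofNat, Int.cast_neg] using h

theorem weight_twelve_equation_2 {d : List ℕ+ →₀ ℚ} (hd : evalBrackets d = 0)
    (hs : (d.support : Set (List ℕ+)) ⊆ indicesUpTo 12 2) :
    (-861665741144812800) * normalizedCoeff d 0 + (-10960532855717760) * normalizedCoeff d 1 +
    (-753534676903680) * normalizedCoeff d 2 + (-113923907485920) * normalizedCoeff d 3 +
    (-29810384104320) * normalizedCoeff d 4 + (-11552935392000) * normalizedCoeff d 5 +
    (-6247657163520) * normalizedCoeff d 6 + (-6361645893120) * normalizedCoeff d 7 +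
    (-6591199910400) * normalizedCoeff d 8 + (-36312172525440) * normalizedCoeff d 9 +
    (-2002183842758400) * normalizedCoeff d 10 + (-1837748427703372800) * normalizedCoeff d 11 = 0 := by
  have h := linear_equation_of_checkCertificate
    317420500360474839007995792449029138890395506893711388667571702634715324065913974451903681795216239608498861149914076285826275702351493405436071013886711735776216604122117771464590926587630129333134966794002512170445768210300705215189050971739181326924929198269723825496996821300378053917233120401215811441951694204700850677806601986426344042165339648733095713134936297073851739637518081068072500454560271971137108943099088263560264404507309690402619585044222974346110576483540009551275414148822036148912128
    1793062995291223254288083140807745206568168056957521955297385844337977372490463171443839353573276051636232787753629017995728331827288946553717385828762639149188236664588457266583307253634786063315943925660874580462107745010642756138890580629605357349119922834900299295816185566013853086831367771895519457213793540039705581925742566152988075729541394293585934892220768790166242332521046692071009375475038947899965482749450051082260373580343690892945776743642905140577099400728395113834733066831792885643915614125817856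
    [-861665741144812800, -10960532855717760, -753534676903680, -113923907485920,
    -29810384104320, -11552935392000, -6247657163520, -6361645893120, -6591199910400,
    -36312172525440, -2002183842758400, -1837748427703372800]
    (by decide +kernel) hd hs
  simpa only [Finset.sum_range_succ, Finset.sum_range_zero, zero_add, List.getD_cons_zero,
    List.getD_cons_succ, Int.cast_ofNat, Int.cast_neg] using h

theorem weight_twelve_equation_3 {d : List ℕ+ →₀ ℚ} (hd : evalBrackets d = 0)
    (hs : (d.support : Set (List ℕ+)) ⊆ indicesUpTo 12 2) :
    5597172821569190400 * normalizedCoeff d 0 + 91009564893999360 * normalizedCoeff d 1 +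
    6449909100526080 * normalizedCoeff d 2 + 985940919663840 * normalizedCoeff d 3 +
    252388274250240 * normalizedCoeff d 4 + 98922854664000 * normalizedCoeff d 5 +
    57472757712000 * normalizedCoeff d 6 + 48421029666240 * normalizedCoeff d 7 + 64676374560000
    * normalizedCoeff d 8 + 157926941464320 * normalizedCoeff d 9 + (-15234939595814400) *
    normalizedCoeff d 10 + 15790163139397785600 * normalizedCoeff d 11 = 0 := by
  have h := linear_equation_of_checkCertificate
    1553602078865816236797980147430661140273322483674039891438738820207491199421581276006910753500766053147818683421196024231216004640645579570922767214329810989375930842437329546142709891214263637920963476812486492533298317253995566296877942301244068325445362428123123497127135979252727156094349773804949640289437830192045075991206390555080609919756280662460057068774287089340332376462421549141591613986913151336359529348903793765490446725597024728440735863029074013061424470945967885128744324899312494624798580502691840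
    224018691594085959812857521447385213988462647402285887162839955474806188919356767332080705983837920220361612180142004443803960121045800990756963421593151108580997806285309114562639588376615838351750693972657821982822159904358393473642730521062428588949998292485321984218341942522712958177254775073478252629203267941693183771671729390462183379748468284141225504819069449696522989405712637278294687995186053335328607076917054813547660352771642532110041755328770928797050553438715303963404711061618688
    [5597172821569190400, 91009564893999360, 6449909100526080, 985940919663840, 252388274250240,
    98922854664000, 57472757712000, 48421029666240, 64676374560000, 157926941464320,
    -15234939595814400, 15790163139397785600]
    (by decide +kernel) hd hs
  simpa only [Finset.sum_range_succ, Finset.sum_range_zero, zero_add, List.getD_cons_zero,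
    List.getD_cons_succ, Int.cast_ofNat, Int.cast_neg] using h

theorem weight_twelve_equation_4 {d : List ℕ+ →₀ ℚ} (hd : evalBrackets d = 0)
    (hs : (d.support : Set (List ℕ+)) ⊆ indicesUpTo 12 2) :
    1521398437120396800 * normalizedCoeff d 0 + 29092868399992320 * normalizedCoeff d 1 +
    2087121309719040 * normalizedCoeff d 2 + 319380575542560 * normalizedCoeff d 3 +
    81495544763520 * normalizedCoeff d 4 + 32022214920000 * normalizedCoeff d 5 + 18789246933120
    * normalizedCoeff d 6 + 15328679768640 * normalizedCoeff d 7 + 21285572394240 *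
    normalizedCoeff d 8 + 53116960619520 * normalizedCoeff d 9 + (-8511837410361600) *
    normalizedCoeff d 10 + 5109902244969984000 * normalizedCoeff d 11 = 0 := by
  have h := linear_equation_of_checkCertificate
    245865140600210856125540293850850334778636868960726544083867003108502114175402979729584433317410677704217683396882383025024158251731201633872709145718839684755443355308076178306642879206418432082285690601667939238539496549827033564609053314903833189273845792812102879108402873057016794661275742482692076344704442227420427457654915953965860699171901196716362761921590059050819894762651278109019133520849438386682163449715235176048146607241288840087718229522604127066744156740918386957482742675958364530873284109008896
    145363350238865406911031157619679259909227344873192349739484536697701348668554069400869006261402120797808028963613992900728954160090401059036934240961195550636245137485790693429508334513766265318776663309874511832318830589264040659119762343790165987794851363792460035412506412901456330534782728288907853271103543412873779804439877529984566812371204034489552123750686551855303242810613817891861937480659419387685773871744084436266112064599945510975482004409035107537618205238009133297149149770214794831331328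
    [1521398437120396800, 29092868399992320, 2087121309719040, 319380575542560, 81495544763520,
    32022214920000, 18789246933120, 15328679768640, 21285572394240, 53116960619520,
    -8511837410361600, 5109902244969984000]
    (by decide +kernel) hd hs
  simpa only [Finset.sum_range_succ, Finset.sum_range_zero, zero_add, List.getD_cons_zero,
    List.getD_cons_succ, Int.cast_ofNat, Int.cast_neg] using h

theorem weight_twelve_equation_5 {d : List ℕ+ →₀ ℚ} (hd : evalBrackets d = 0)
    (hs : (d.support : Set (List ℕ+)) ⊆ indicesUpTo 12 2) :
    (-1022428016371641600) * normalizedCoeff d 0 + (-10960607897850240) * normalizedCoeff d 1 +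
    (-731447211479040) * normalizedCoeff d 2 + (-110061879157440) * normalizedCoeff d 3 +
    (-29025822493440) * normalizedCoeff d 4 + (-11207911464000) * normalizedCoeff d 5 +
    (-5906074435200) * normalizedCoeff d 6 + (-6419364920640) * normalizedCoeff d 7 +
    (-5990052902400) * normalizedCoeff d 8 + (-45515543794560) * normalizedCoeff d 9 +
    (-5422429409241600) * normalizedCoeff d 10 + (-1780252600133145600) * normalizedCoeff d 11 = 0 := by
  have h := linear_equation_of_checkCertificate
    395705691731807591202930515239523656743160824322684057275007672595354663591331103219240859786117879873176344643473026197327684196913560897708618452925216157142232752479433329420618449951565690095765819818306951428526001751520184439489909374134084840569416889030438874285059635706282378661348249981678441217435589933890340574177088316449243542359264096372005568157055168352401237750271297936993360150438292194385040460430870098231850563733683486993992380268989149833886941885219649644768696458432208212852736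
    2222861117498990663773304800136867923696518675179681022627758557592002058561307442820941317844562219949614711659624200470407976961198061767591375612468404421893614811149445347910266763302371501098682434371546277387421989814503920086569894618122283075426360270834094918627719552603898536583460871182874462116882694562428145931595456902245046059904959452949449310643046957201140750035953696536500205911801278394808528706129871953138091703685740701652717376751835821710068226748249260693922564513280195604933571178921984
    [-1022428016371641600, -10960607897850240, -731447211479040, -110061879157440,
    -29025822493440, -11207911464000, -5906074435200, -6419364920640, -5990052902400,
    -45515543794560, -5422429409241600, -1780252600133145600]
    (by decide +kernel) hd hs
  simpa only [Finset.sum_range_succ, Finset.sum_range_zero, zero_add, List.getD_cons_zero,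
    List.getD_cons_succ, Int.cast_ofNat, Int.cast_neg] using h

theorem weight_twelve_equation_6 {d : List ℕ+ →₀ ℚ} (hd : evalBrackets d = 0)
    (hs : (d.support : Set (List ℕ+)) ⊆ indicesUpTo 12 2) :
    (-3861789265338681600) * normalizedCoeff d 0 + (-57008835264084480) * normalizedCoeff d 1 +
    (-3989440668971520) * normalizedCoeff d 2 + (-607435542645120) * normalizedCoeff d 3 +
    (-156768285703680) * normalizedCoeff d 4 + (-61211317593600) * normalizedCoeff d 5 +
    (-34631584231680) * normalizedCoeff d 6 + (-31264365484800) * normalizedCoeff d 7 +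
    (-38275113219840) * normalizedCoeff d 8 + (-129625917926400) * normalizedCoeff d 9 +
    1355123239545600 * normalizedCoeff d 10 + (-9754091450043494400) * normalizedCoeff d 11 = 0 := by
  have h := linear_equation_of_checkCertificate
    565148086417151506997878685409766003457027590339588595420261668924146789718236510613300342773949245243070129671020789737926925656610053945909700364808370379936057396474818723031182774443732840558409715070183512330630470985905867803049142040129445459668986914779489531784702385226523629338111222120920336888130233124851951467040884379924901133239167845648112784092406062217798580734023657346551364786095281902037542850264161638247988771260222957096811572036992218389075651812939544496269743490118516043939840
    2340271893861266297194957611896069666260017348483615297136947820849372839165057260613309651925542745064702155848420127423329160690453028402871247798359523550455806723627065219474489219071076313507183251733366887818468472771245056423420395937735777847671280960461636847913087006287122446357597314976619697254061121449814433130060630903632684814934779395801581942608802757038069763835901958481573955752313378955830787845574635174171338537677726144901089669277575345349644177155236210325658140663691815665815110975225856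
    [-3861789265338681600, -57008835264084480, -3989440668971520, -607435542645120,
    -156768285703680, -61211317593600, -34631584231680, -31264365484800, -38275113219840,
    -129625917926400, 1355123239545600, -9754091450043494400]
    (by decide +kernel) hd hs
  simpa only [Finset.sum_range_succ, Finset.sum_range_zero, zero_add, List.getD_cons_zero,
    List.getD_cons_succ, Int.cast_ofNat, Int.cast_neg] using h

/-- The coefficients of weight twelve of a relation between brackets of weight at most twelve and
length at most two. -/
theorem weight_twelve_equations {d : List ℕ+ →₀ ℚ} (hd : evalBrackets d = 0)
    (hs : (d.support : Set (List ℕ+)) ⊆ indicesUpTo 12 2) :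
    normalizedCoeff d 0 = 0 ∧
    normalizedCoeff d 1 = (-10) * normalizedCoeff d 10 ∧
    normalizedCoeff d 5 = (-101/3) * normalizedCoeff d 2 + (-17/4) * normalizedCoeff d 3 + (-12/7) * normalizedCoeff d 4 + 4893 * normalizedCoeff d 10 + (-83160) * normalizedCoeff d 11 ∧
    normalizedCoeff d 6 = (-57/2) * normalizedCoeff d 2 + (-45/8) * normalizedCoeff d 3 + (-5/14) * normalizedCoeff d 4 + (8085/2) * normalizedCoeff d 10 + (-69300) * normalizedCoeff d 11 ∧
    normalizedCoeff d 7 = (-70/3) * normalizedCoeff d 2 + (-7/2) * normalizedCoeff d 3 + (-1) * normalizedCoeff d 4 + 3240 * normalizedCoeff d 10 + (-55440) * normalizedCoeff d 11 ∧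
    normalizedCoeff d 8 = (-31/6) * normalizedCoeff d 2 + (-9/8) * normalizedCoeff d 3 + (-3/14) * normalizedCoeff d 4 + (1635/2) * normalizedCoeff d 10 + (-13860) * normalizedCoeff d 11 ∧
    normalizedCoeff d 9 = (-1/9) * normalizedCoeff d 2 + (-5) * normalizedCoeff d 10 := by
  have h0 := weight_twelve_equation_0 hd hs
  have h1 := weight_twelve_equation_1 hd hs
  have h2 := weight_twelve_equation_2 hd hs
  have h3 := weight_twelve_equation_3 hd hs
  have h4 := weight_twelve_equation_4 hd hs
  have h5 := weight_twelve_equation_5 hd hs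
  have h6 := weight_twelve_equation_6 hd hs
  -- The system is solved for the unknowns 0, 1, 5, 6, 7, 8, 9, while 2, 3, 4, 10, 11 stay free.
  -- Each list of multipliers is a row of the inverse of the 7×7 matrix of the solved unknowns.
  refine ⟨?_, ?_, ?_, ?_, ?_, ?_, ?_⟩
  · linear_combination
      (-1459982626799757692259750661366194379927339/11025954039958701637867207812945731895134153776897745664000)
      * h0 +
      (-14088079333462083377267178236080468263121/204184334073309289590133478017513553613595440312921216000)
      * h1 +
      (-385747269307697551487190827973813207362869/11025954039958701637867207812945731895134153776897745664000)
      * h2 +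
      (10594290059195378055534071201847404656519/1102595403995870163786720781294573189513415377689774566400)
      * h3 +
      (2439191424904965885438842737748182643927/225019470203238808936065465570321059084370485242811136000)
      * h4 +
      (4886609084917280816761966577748364510867/63005451656906866502098330359689896543623735867987118080)
      * h5 +
      (-238098322919692053709644623070130076855027/11025954039958701637867207812945731895134153776897745664000)
      * h6
  · linear_combination
      (197670244000432698215518448444814493022774393/2205190807991740327573441562589146379026830755379549132800)
      * h0 +
      (53819180021482633514343892060012694239382599/1102595403995870163786720781294573189513415377689774566400)
      * h1 +
      (58277877831872722975511755420627591510745023/2205190807991740327573441562589146379026830755379549132800)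
      * h2 +
      (-1196111048302718446769061181088549720098957/220519080799174032757344156258914637902683075537954913280)
      * h3 +
      (-344244353529285365238813669859849411049527/35003028698281592501165739088716609190902075482215065600)
      * h4 +
      (-469017371536317272401764874320095121499543/9000778808129552357442618622812842363374819409712445440)
      * h5 +
      (29573104299464752996580983960664883059425789/2205190807991740327573441562589146379026830755379549132800)
      * h6
  · linear_combination
      (-12135007944512536189015316146752251715676903379/29402544106556537700979220834521951720357743405060655104)
      * h0 +
      (-99619046364556036703907987519556258810245675359/367531801331956721262240260431524396504471792563258188800)
      * h1 +
      (4965395876122916027621537534357535106901337539/735063602663913442524480520863048793008943585126516377600)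
      * h2 +
      (175222470645641325155703393424504180453580171/367531801331956721262240260431524396504471792563258188800)
      * h3 +
      (7725038829258012906087083259042320975898657457/105009086094844777503497217266149827572706226446645196800)
      * h4 +
      (2224215450595005731971307977550687919832028509/15001298013549253929071031038021403938958032349520742400)
      * h5 +
      (-51987189553316644445932731690855964511191178099/735063602663913442524480520863048793008943585126516377600)
      * h6
  · linear_combination
      (11420118157110331538112210279093188216348984537/98008480355188459003264069448406505734525811350202183680)
      * h0 +
      (10361076526074447335739914447895736695450097007/147012720532782688504896104172609758601788717025303275520)
      * h1 +
      (-459071673387441153346201413684374083075528049/98008480355188459003264069448406505734525811350202183680)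
      * h2 +
      (42475804891029475122355529160022973436159689/29402544106556537700979220834521951720357743405060655104)
      * h3 +
      (-27986821883525808678204247509875670272407043/1555690164368070777829588403942960408484536688098447360)
      * h4 +
      (-323278836896897017396076074428885315065137517/6000519205419701571628412415208561575583212939808296960)
      * h5 +
      (8742640342564341050101121369770709688385848451/294025441065565377009792208345219517203577434050606551040)
      * h6
  · linear_combination
      (105100832311264342600941130941445160136381295127/367531801331956721262240260431524396504471792563258188800)
      * h0 +
      (35697079951135221080908634756389363556064518771/183765900665978360631120130215762198252235896281629094400)
      * h1 +
      (-3021783680979157272104227327904534066260115381/122510600443985573754080086810508132168157264187752729600)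
      * h2 +
      (93696384615944733575724134197503408845222153/36753180133195672126224026043152439650447179256325818880)
      * h3 +
      (-414721034314833022462791377281405431387789211/7500649006774626964535515519010701969479016174760371200)
      * h4 +
      (-305326706499789417688664722016644724841568457/3500302869828159250116573908871660919090207548221506560)
      * h5 +
      (18036986191508065009883888188659030879321150191/367531801331956721262240260431524396504471792563258188800)
      * h6
  · linear_combination
      (13578606127835729561495407948450101527295930989/70006057396563185002331478177433218381804150964430131200)
      * h0 +
      (4898206451404403354021264077191008472543346537/35003028698281592501165739088716609190902075482215065600)
      * h1 +
      (-4381869520136229332473232448402121328671934143/210018172189689555006994434532299655145412452893290393600)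
      * h2 +
      (57401492197139139645666240434439814274906381/21001817218968955500699443453229965514541245289329039360)
      * h3 +
      (-8644431312907229376102888546246939011464222579/210018172189689555006994434532299655145412452893290393600)
      * h4 +
      (-1935835583411672456027485601438772758202595837/42003634437937911001398886906459931029082490578658078720)
      * h5 +
      (5726927768625067774543123024024212644774629951/210018172189689555006994434532299655145412452893290393600)
      * h6
  · linear_combination
      (80349105508825509415738105478296037656313753/39378407285566791563811456474806185339764834917491948800)
      * h0 +
      (17792501424123318299346672044549152280847343/11250973510161940446803273278516052954218524262140556800)
      * h1 +
      (-16112608815193391500020246158720803469890327/39378407285566791563811456474806185339764834917491948800)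
      * h2 +
      (86938080198443839684547610997696105599181/1312613576185559718793715215826872844658827830583064960)
      * h3 +
      (-4959894097116303545156117564652837750591731/11250973510161940446803273278516052954218524262140556800)
      * h4 +
      (-165369079881470727538985369770833122923793/450038940406477617872130931140642118168740970485622272)
      * h5 +
      (7945353600173844225357902869288430943754691/26252271523711194375874304316537456893176556611661299200)
      * h6

/-! ### The six representations -/

theorem representsDelta_iff {r : List ℕ+ →₀ ℚ} :
    RepresentsDelta r ↔ evalBrackets r = PowerSeries.mk discriminantCoeff := by
  rw [RepresentsDelta, qExpansion_discriminant]
  exact (PowerSeries.map_injective _ (algebraMap ℚ ℂ).injective).eq_iff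

theorem evalBrackets_add (r s : List ℕ+ →₀ ℚ) :
    evalBrackets (r + s) = evalBrackets r + evalBrackets s := map_add _ r s

theorem evalBrackets_sub (r s : List ℕ+ →₀ ℚ) :
    evalBrackets (r - s) = evalBrackets r - evalBrackets s := map_sub _ r s

theorem evalBrackets_smul (c : ℚ) (r : List ℕ+ →₀ ℚ) :
    evalBrackets (c • r) = c • evalBrackets r := map_smul _ c r

theorem evalBrackets_single (s : List ℕ+) (x : ℚ) :
    evalBrackets (Finsupp.single s x) = x • bracket s := Finsupp.linearCombination_single _ _ _

/-- The normalized coefficients of the brackets of length two in the representation of the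
discriminant whose brackets of length one are `[a]` and `[b]`. -/
def deltaCoeffs : ℕ → List ℚ
  | 2 => [0, 0, 0, -212/45, -742/15, -5213/45, 1465/6, 10168/45, 559/10, 0, 0]
  | 4 => [0, 0, 0, -82/9, -287/3, -323/18, 3425/12, 2588/9, 283/4, 0, 0]
  | 6 => [0, 0, 0, -1019/18, -287/3, 13243/72, 26525/48, 16337/36, 1987/16, 0, 0]
  | 8 => [0, 0, -1377/32, -8207/72, 11473/48, 187595/144, 190291/96, 190655/144, 10859/32, 153/32, 0]
  | 10 => [0, -2685/128, -15849/256, 56081/144, 982667/384, 1752595/288, 2818411/384, 644957/144, 278581/256, -231/64, 537/256]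
  | 11 => [0, 10365/256, 279855/512, 1782089/576, 7318381/768, 19897345/1152, 14162045/768, 6176849/576, 1321883/512, -10365/256, -2073/512]
  | _ => []

/-- The representation of the discriminant by `[a]`, `[b]` and the `[m, n]` with `m + n = 12`. -/
noncomputable def deltaRep (p : ℕ+ × ℕ+) : List ℕ+ →₀ ℚ :=
  Finsupp.single [p.1] ((2 ^ (p.2 : ℕ) + 50) / (2 ^ (p.2 : ℕ) - 2 ^ (p.1 : ℕ)) *
      (((p.1 : ℕ) - 1).factorial : ℚ)) +
    Finsupp.single [p.2] ((2 ^ (p.1 : ℕ) + 50) / (2 ^ (p.1 : ℕ) - 2 ^ (p.2 : ℕ)) *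
      (((p.2 : ℕ) - 1).factorial : ℚ)) +
    ∑ r ∈ Finset.range 11, Finsupp.single (pairIndex r)
      ((deltaCoeffs p.1).getD r 0 * ((r.factorial : ℚ) * ((10 - r).factorial : ℚ)))

theorem coeff_evalBrackets_deltaRep (p : ℕ+ × ℕ+) (n : ℕ) :
    coeff n (evalBrackets (deltaRep p)) =
      (2 ^ (p.2 : ℕ) + 50) / (2 ^ (p.2 : ℕ) - 2 ^ (p.1 : ℕ)) * divisorSum ((p.1 : ℕ) - 1) n +
      (2 ^ (p.1 : ℕ) + 50) / (2 ^ (p.1 : ℕ) - 2 ^ (p.2 : ℕ)) * divisorSum ((p.2 : ℕ) - 1) n +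
      ∑ r ∈ Finset.range 11, (deltaCoeffs p.1).getD r 0 * doubleDivisorSum r (10 - r) n := by
  have hf : ∀ k : ℕ, (k.factorial : ℚ) ≠ 0 := fun k => Nat.cast_ne_zero.2 k.factorial_ne_zero
  have hsum : evalBrackets (∑ r ∈ Finset.range 11, Finsupp.single (pairIndex r)
      ((deltaCoeffs p.1).getD r 0 * ((r.factorial : ℚ) * ((10 - r).factorial : ℚ)))) =
      ∑ r ∈ Finset.range 11, ((deltaCoeffs p.1).getD r 0 * ((r.factorial : ℚ) *
        ((10 - r).factorial : ℚ))) • bracket (pairIndex r) := by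
    simp only [evalBrackets, map_sum, Finsupp.linearCombination_single]
  rw [deltaRep, evalBrackets_add, evalBrackets_add, evalBrackets_single, evalBrackets_single,
    hsum]
  simp only [map_add, map_sum, coeff_smul, smul_eq_mul, coeff_bracket_singleton]
  congr 1
  · congr 1 <;> rw [mul_assoc, mul_div_cancel₀ _ (hf _)]
  · refine Finset.sum_congr rfl fun r _ => ?_
    rw [pairIndex, coeff_bracket_pair]
    simp only [Nat.succPNat_coe, Nat.succ_eq_add_one, Nat.add_sub_cancel]
    rw [mul_assoc, mul_div_cancel₀ _ (mul_ne_zero (hf _) (hf _))]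

theorem forall_mem_deltaPairs {P : ℕ+ × ℕ+ → Prop} :
    (∀ p ∈ deltaPairs, P p) ↔
      P (2, 4) ∧ P (4, 6) ∧ P (6, 8) ∧ P (8, 10) ∧ P (10, 11) ∧ P (11, 12) := by
  simp only [deltaPairs, Finset.mem_insert, Finset.mem_singleton, forall_eq_or_imp, forall_eq]

/-- In each case the stuffle and shuffle coefficients for (3,7) add up to −115200/1728 = −200/3 and
those for (5,5) to 254016/1728 = 147, which matches the convolutions in Δ; for every other (r,s)
they cancel. The shuffle coefficients sum to 0, which removes nσ₉(n). The remaining freedom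
eliminates all single divisor sums except those of [a] and [b]. -/
theorem representsDelta_deltaRep : ∀ p ∈ deltaPairs, RepresentsDelta (deltaRep p) := by
  simp only [representsDelta_iff, PowerSeries.ext_iff, coeff_evalBrackets_deltaRep, coeff_mk,
    forall_mem_deltaPairs]
  refine ⟨fun n => ?_, fun n => ?_, fun n => ?_, fun n => ?_, fun n => ?_, fun n => ?_⟩
  · simp only [Finset.sum_range_succ, Finset.sum_range_zero, deltaCoeffs, PNat.val_ofNat,
      List.getD_cons_zero, List.getD_cons_succ, Nat.reduceSub, discriminantCoeff]
    linear_combination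
      (-803/90) * stuffle_2_8 n + (-1712/45) * stuffle_3_7 n + (1151/90) * stuffle_4_6 n +
      (5153/45) * stuffle_5_5 n + (803/90) * shuffle_2_8 n + (-1288/45) * shuffle_3_7 n +
      (-1151/90) * shuffle_4_6 n + (1462/45) * shuffle_5_5 n
  · simp only [Finset.sum_range_succ, Finset.sum_range_zero, deltaCoeffs, PNat.val_ofNat,
      List.getD_cons_zero, List.getD_cons_succ, Nat.reduceSub, discriminantCoeff]
    linear_combination
      (-341/36) * stuffle_2_8 n + (-382/9) * stuffle_3_7 n + (1787/36) * stuffle_4_6 n +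
      (1487/18) * stuffle_5_5 n + (341/36) * shuffle_2_8 n + (-218/9) * shuffle_3_7 n +
      (-1787/36) * shuffle_4_6 n + (1159/18) * shuffle_5_5 n
  · simp only [Finset.sum_range_succ, Finset.sum_range_zero, deltaCoeffs, PNat.val_ofNat,
      List.getD_cons_zero, List.getD_cons_succ, Nat.reduceSub, discriminantCoeff]
    linear_combination
      (-2219/144) * stuffle_2_8 n + (-673/36) * stuffle_3_7 n + (8003/144) * stuffle_4_6 n +
      (2119/36) * stuffle_5_5 n + (2219/144) * shuffle_2_8 n + (-1727/36) * shuffle_3_7 n +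
      (-8003/144) * shuffle_4_6 n + (3173/36) * shuffle_5_5 n
  · simp only [Finset.sum_range_succ, Finset.sum_range_zero, deltaCoeffs, PNat.val_ofNat,
      List.getD_cons_zero, List.getD_cons_succ, Nat.reduceSub, discriminantCoeff]
    linear_combination
      (-153/32) * stuffle_1_9 n + (-307/288) * stuffle_2_8 n + (4193/144) * stuffle_3_7 n +
      (11875/288) * stuffle_4_6 n + (4559/288) * stuffle_5_5 n + (153/32) * shuffle_1_9 n +
      (307/288) * shuffle_2_8 n + (-13793/144) * shuffle_3_7 n + (-11875/288) * shuffle_4_6 n +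
      (37777/288) * shuffle_5_5 n
  · simp only [Finset.sum_range_succ, Finset.sum_range_zero, deltaCoeffs, PNat.val_ofNat,
      List.getD_cons_zero, List.getD_cons_succ, Nat.reduceSub, discriminantCoeff]
    linear_combination
      (-537/256) * stuffle_0_10 n + (231/64) * stuffle_1_9 n + (128035/2304) * stuffle_2_8 n +
      (13859/144) * stuffle_3_7 n + (-15329/1152) * stuffle_4_6 n + (-34379/576) * stuffle_5_5 n
      + (537/256) * shuffle_0_10 n + (-231/64) * shuffle_1_9 n + (-128035/2304) * shuffle_2_8 n
      + (-23459/144) * shuffle_3_7 n + (15329/1152) * shuffle_4_6 n + (119051/576) * shuffle_5_5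
      n
  · simp only [Finset.sum_range_succ, Finset.sum_range_zero, deltaCoeffs, PNat.val_ofNat,
      List.getD_cons_zero, List.getD_cons_succ, Nat.reduceSub, discriminantCoeff]
    linear_combination
      (2073/512) * stuffle_0_10 n + (10365/256) * stuffle_1_9 n + (624269/4608) * stuffle_2_8 n
      + (83759/576) * stuffle_3_7 n + (-228919/2304) * stuffle_4_6 n + (-335777/2304) *
      stuffle_5_5 n + (-2073/512) * shuffle_0_10 n + (-10365/256) * shuffle_1_9 n +
      (-624269/4608) * shuffle_2_8 n + (-122159/576) * shuffle_3_7 n + (228919/2304) *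
      shuffle_4_6 n + (674465/2304) * shuffle_5_5 n

theorem deltaRep_apply_pairIndex (p : ℕ+ × ℕ+) {r : ℕ} (hr : r < 11) :
    deltaRep p (pairIndex r) =
      (deltaCoeffs p.1).getD r 0 * ((r.factorial : ℚ) * ((10 - r).factorial : ℚ)) := by
  simp only [deltaRep, Finsupp.add_apply, Finsupp.finsetSum_apply, Finsupp.single_apply,
    (pairIndex_ne_singleton r _).symm, if_false, zero_add, pairIndex_injective.eq_iff]
  rw [Finset.sum_ite_eq' (Finset.range 11) r, if_pos (Finset.mem_range.2 hr)]

theorem deltaRep_apply_singleton (p : ℕ+ × ℕ+) (x : ℕ+) :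
    deltaRep p [x] =
      (if p.1 = x then (2 ^ (p.2 : ℕ) + 50) / (2 ^ (p.2 : ℕ) - 2 ^ (p.1 : ℕ)) *
        (((p.1 : ℕ) - 1).factorial : ℚ) else 0) +
      (if p.2 = x then (2 ^ (p.1 : ℕ) + 50) / (2 ^ (p.1 : ℕ) - 2 ^ (p.2 : ℕ)) *
        (((p.2 : ℕ) - 1).factorial : ℚ) else 0) := by
  simp only [deltaRep, Finsupp.add_apply, Finsupp.finsetSum_apply, Finsupp.single_apply,
    pairIndex_ne_singleton, if_false, Finset.sum_const_zero, add_zero, List.cons.injEq, and_true]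

theorem support_deltaRep (p : ℕ+ × ℕ+) :
    ((deltaRep p).support : Set (List ℕ+)) ⊆ {[p.1], [p.2]} ∪ pairIndices 12 := by
  intro s hs
  rw [Finset.mem_coe, Finsupp.mem_support_iff] at hs
  by_contra h
  simp only [Set.mem_union, Set.mem_insert_iff, Set.mem_singleton_iff, not_or,
    mem_pairIndices_iff, not_exists, not_and] at h
  obtain ⟨⟨h1, h2⟩, h3⟩ := h
  refine hs ?_
  simp only [deltaRep, Finsupp.add_apply, Finsupp.finsetSum_apply, Finsupp.single_apply]
  rw [if_neg (Ne.symm h1), if_neg (Ne.symm h2), Finset.sum_eq_zero, add_zero, add_zero]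
  exact fun r hr => if_neg (Ne.symm (h3 r (Finset.mem_range.1 hr)))

theorem indexWeight_singleton (a : ℕ+) : indexWeight [a] = a := by
  simp [indexWeight]

theorem singleton_mem_indicesUpTo {a : ℕ+} {k : ℕ} (h : (a : ℕ) ≤ k) : [a] ∈ indicesUpTo k 1 :=
  ⟨(indexWeight_singleton a).trans_le h, le_rfl⟩

theorem support_deltaRep_subset : ∀ p ∈ deltaPairs,
    ((deltaRep p).support : Set (List ℕ+)) ⊆ indicesUpTo 12 1 ∪ pairIndices 12 := by
  intro p hp
  refine (support_deltaRep p).trans (Set.union_subset_union_left _ ?_)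
  have h : ∀ p ∈ deltaPairs, (p.1 : ℕ) ≤ 12 ∧ (p.2 : ℕ) ≤ 12 := by decide
  rintro s (rfl | rfl)
  · exact singleton_mem_indicesUpTo (h p hp).1
  · exact singleton_mem_indicesUpTo (h p hp).2

theorem union_subset_indicesUpTo :
    indicesUpTo 12 1 ∪ pairIndices 12 ⊆ indicesUpTo 12 2 := by
  rintro s (⟨h1, h2⟩ | ⟨h1, h2⟩)
  · exact ⟨h1, h2.trans one_le_two⟩
  · exact ⟨h1.le, h2.le⟩

/-! ### Reduction of an arbitrary representation to the six -/

theorem normalizedCoeff_add (d e : List ℕ+ →₀ ℚ) (r : ℕ) :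
    normalizedCoeff (d + e) r = normalizedCoeff d r + normalizedCoeff e r := by
  simp only [normalizedCoeff, Finsupp.add_apply]
  split_ifs <;> ring

theorem normalizedCoeff_sub (d e : List ℕ+ →₀ ℚ) (r : ℕ) :
    normalizedCoeff (d - e) r = normalizedCoeff d r - normalizedCoeff e r := by
  simp only [normalizedCoeff, Finsupp.sub_apply]
  split_ifs <;> ring

theorem normalizedCoeff_smul (c : ℚ) (d : List ℕ+ →₀ ℚ) (r : ℕ) :
    normalizedCoeff (c • d) r = c * normalizedCoeff d r := by
  simp only [normalizedCoeff, Finsupp.smul_apply, smul_eq_mul]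
  split_ifs <;> ring

theorem normalizedCoeff_deltaRep (p : ℕ+ × ℕ+) {r : ℕ} (hr : r < 11) :
    normalizedCoeff (deltaRep p) r = (deltaCoeffs p.1).getD r 0 := by
  rw [normalizedCoeff, if_neg hr.ne, deltaRep_apply_pairIndex p hr, mul_div_cancel_right₀]
  exact mul_ne_zero (Nat.cast_ne_zero.2 r.factorial_ne_zero)
    (Nat.cast_ne_zero.2 (10 - r).factorial_ne_zero)

/-- The value −1049/1024 is (2¹¹ + 50)/(2¹¹ − 2¹²), from the pair (11, 12). -/
theorem normalizedCoeff_deltaRep_eleven : ∀ p ∈ deltaPairs,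
    normalizedCoeff (deltaRep p) 11 = if p.2 = 12 then -1049 / 1024 else 0 := by
  simp only [normalizedCoeff, if_true, deltaRep_apply_singleton, forall_mem_deltaPairs]
  refine ⟨?_, ?_, ?_, ?_, ?_, ?_⟩
  all_goals
    simp only [show ((2 : ℕ+) = 12) = False by decide, show ((4 : ℕ+) = 12) = False by decide,
      show ((6 : ℕ+) = 12) = False by decide, show ((8 : ℕ+) = 12) = False by decide,
      show ((10 : ℕ+) = 12) = False by decide, show ((11 : ℕ+) = 12) = False by decide,
      if_false, PNat.val_ofNat, Nat.reduceSub, add_zero, zero_add, zero_div]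
  rw [mul_div_cancel_right₀ _ (Nat.cast_ne_zero.2 (Nat.factorial_ne_zero 11))]
  norm_num

/-- A representation of zero all of whose coefficients of weight twelve vanish in five places is
supported in weight at most eleven. -/
theorem support_subset_of_normalizedCoeff {d : List ℕ+ →₀ ℚ} (hd : evalBrackets d = 0)
    (hs : (d.support : Set (List ℕ+)) ⊆ indicesUpTo 12 2)
    (h2 : normalizedCoeff d 2 = 0) (h3 : normalizedCoeff d 3 = 0) (h4 : normalizedCoeff d 4 = 0)
    (h10 : normalizedCoeff d 10 = 0) (h11 : normalizedCoeff d 11 = 0) :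
    (d.support : Set (List ℕ+)) ⊆ indicesUpTo 11 2 := by
  have hall : ∀ r < 12, normalizedCoeff d r = 0 := by
    have h := weight_twelve_equations hd hs
    simp only [h2, h3, h4, h10, h11, mul_zero, add_zero] at h
    intro r hr
    interval_cases r <;> tauto
  have htop : ∀ s ∈ topIndices, d s = 0 := by
    intro s hs
    rcases mem_topIndices.1 hs with rfl | ⟨r, hr, rfl⟩
    · have := hall 11 (by norm_num)
      rw [normalizedCoeff, if_pos rfl, div_eq_zero_iff] at this
      exact this.resolve_right (Nat.cast_ne_zero.2 (Nat.factorial_ne_zero 11))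
    · have := hall r (by omega)
      rw [normalizedCoeff, if_neg hr.ne, div_eq_zero_iff] at this
      exact this.resolve_right (mul_ne_zero (Nat.cast_ne_zero.2 r.factorial_ne_zero)
        (Nat.cast_ne_zero.2 (10 - r).factorial_ne_zero))
  intro s h
  refine ⟨?_, (hs h).2⟩
  by_contra hw
  have hw12 : indexWeight s = 12 := le_antisymm (hs h).1 (by omega)
  refine Finsupp.mem_support_iff.1 h (htop s (mem_topIndices.2 ?_))
  rcases indicesUpTo_twelve (hs h) with rfl | ⟨a, rfl, ha⟩ | ⟨a, b, rfl, hab⟩ | h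
  · simp [indexWeight] at hw12
  · rw [indexWeight_singleton] at hw12
    omega
  · exact Or.inr (mem_pairIndices_iff.1 ⟨hw12, rfl⟩)
  · exact mem_topIndices.1 h

theorem support_sub_subset {d e : List ℕ+ →₀ ℚ} {S : Set (List ℕ+)}
    (hd : (d.support : Set (List ℕ+)) ⊆ S) (he : (e.support : Set (List ℕ+)) ⊆ S) :
    ((d - e).support : Set (List ℕ+)) ⊆ S := fun _ hs =>
  (Finset.mem_union.1 (Finsupp.support_sub hs)).elim (fun h => hd h) fun h => he h

theorem support_subset_of_mem_span {r : List ℕ+ →₀ ℚ}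
    (hr : r ∈ Submodule.span ℚ (deltaRep '' (deltaPairs : Set (ℕ+ × ℕ+)))) :
    (r.support : Set (List ℕ+)) ⊆ indicesUpTo 12 1 ∪ pairIndices 12 := by
  have h : Submodule.span ℚ (deltaRep '' (deltaPairs : Set (ℕ+ × ℕ+))) ≤
      Finsupp.supported ℚ ℚ (indicesUpTo 12 1 ∪ pairIndices 12) := by
    rw [Submodule.span_le]
    rintro _ ⟨p, hp, rfl⟩
    exact support_deltaRep_subset p hp
  exact h hr

/-- In weight twelve a relation is determined by its coordinates 2, 3, 4, 10, 11, and the five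
differences of the representations from the first one attain all values there. A combination of the
six thus matches r in weight twelve. -/
theorem exists_sub_support_subset {r : List ℕ+ →₀ ℚ} (hr : RepresentsDelta r)
    (hs : (r.support : Set (List ℕ+)) ⊆ indicesUpTo 12 2) :
    ∃ r₀ ∈ Submodule.span ℚ (deltaRep '' (deltaPairs : Set (ℕ+ × ℕ+))),
      ((r - r₀).support : Set (List ℕ+)) ⊆ indicesUpTo 11 2 ∧ evalBrackets (r - r₀) = 0 := by
  set d := r - deltaRep (2, 4) with hd
  set y := normalizedCoeff d with hy
  have hmem : ∀ p ∈ deltaPairs,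
      deltaRep p ∈ Submodule.span ℚ (deltaRep '' (deltaPairs : Set (ℕ+ × ℕ+))) :=
    fun p hp => Submodule.subset_span ⟨p, hp, rfl⟩
  have heval := representsDelta_deltaRep
  simp only [representsDelta_iff, forall_mem_deltaPairs] at heval hr
  rw [forall_mem_deltaPairs] at hmem
  obtain ⟨m1, m2, m3, m4, m5, m6⟩ := hmem
  obtain ⟨e1, e2, e3, e4, e5, e6⟩ := heval
  have h11 := normalizedCoeff_deltaRep_eleven
  rw [forall_mem_deltaPairs] at h11
  obtain ⟨n1, n2, n3, n4, n5, n6⟩ := h11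
  -- The multipliers solve a block triangular system. Only (11, 12) meets coordinate 11; among the
  -- others only (10, 11) meets coordinate 10, and after that only (8, 10) meets coordinate 2. The
  -- differences for (4, 6) and (6, 8) then adjust coordinates 3 and 4.
  set r₀ := deltaRep (2, 4) +
    ((-72408/209) * y 11 + (4012/209) * y 10 + (-1994/9405) * y 2 + (2/95) * y 3 + (-173/7315) * y 4) •
      (deltaRep (4, 6) - deltaRep (2, 4)) +
    ((-22112/969) * y 11 + (9992/2907) * y 10 + (8752/130815) * y 2 + (-2/95) * y 3 + (4/1995) * y 4) •
      (deltaRep (6, 8) - deltaRep (2, 4)) +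
    ((-88448/9129) * y 11 + (-18784/27387) * y 10 + (-32/1377) * y 2) •
      (deltaRep (8, 10) - deltaRep (2, 4)) +
    ((-353792/187771) * y 11 + (256/537) * y 10) • (deltaRep (10, 11) - deltaRep (2, 4)) +
    ((-1024/1049) * y 11) • (deltaRep (11, 12) - deltaRep (2, 4)) with hr₀
  have hr₀mem : r₀ ∈ Submodule.span ℚ (deltaRep '' (deltaPairs : Set (ℕ+ × ℕ+))) := by
    have hsub : ∀ {f : List ℕ+ →₀ ℚ} (c : ℚ),
        f ∈ Submodule.span ℚ (deltaRep '' (deltaPairs : Set (ℕ+ × ℕ+))) →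
        c • (f - deltaRep (2, 4)) ∈ Submodule.span ℚ (deltaRep '' (deltaPairs : Set (ℕ+ × ℕ+))) :=
      fun c hf => Submodule.smul_mem _ c (Submodule.sub_mem _ hf m1)
    exact Submodule.add_mem _ (Submodule.add_mem _ (Submodule.add_mem _ (Submodule.add_mem _
      (Submodule.add_mem _ m1 (hsub _ m2)) (hsub _ m3)) (hsub _ m4)) (hsub _ m5)) (hsub _ m6)
  have h0 : evalBrackets (r - r₀) = 0 := by
    rw [hr₀]
    simp only [evalBrackets_sub, evalBrackets_add, evalBrackets_smul, hr, e1, e2, e3, e4, e5, e6,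
      sub_self, smul_zero, add_zero]
  refine ⟨r₀, hr₀mem, support_subset_of_normalizedCoeff h0 (support_sub_subset hs
    ((support_subset_of_mem_span hr₀mem).trans union_subset_indicesUpTo)) ?_ ?_ ?_ ?_ ?_, h0⟩
  all_goals
    rw [show r - r₀ = d - (r₀ - deltaRep (2, 4)) by rw [hd]; abel, hr₀]
    simp only [normalizedCoeff_sub, normalizedCoeff_add, normalizedCoeff_smul, ← hy]
  on_goal 5 =>
    rw [n1, n2, n3, n4, n5, n6]
    simp only [show ((4 : ℕ+) = 12) = False by decide,
      show ((6 : ℕ+) = 12) = False by decide, show ((8 : ℕ+) = 12) = False by decide,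
      show ((10 : ℕ+) = 12) = False by decide, show ((11 : ℕ+) = 12) = False by decide,
      if_true, if_false]
    ring
  all_goals
    simp only [normalizedCoeff_deltaRep _ (show 2 < 11 by norm_num),
      normalizedCoeff_deltaRep _ (show 3 < 11 by norm_num),
      normalizedCoeff_deltaRep _ (show 4 < 11 by norm_num),
      normalizedCoeff_deltaRep _ (show 10 < 11 by norm_num), deltaCoeffs, PNat.val_ofNat,
      List.getD_cons_zero, List.getD_cons_succ]
    ring

/-! ### Independence of the brackets of length at most one -/

theorem multipleDivisorSum_nil_zero : multipleDivisorSum [] 0 = 1 := by decide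

theorem divisorSum_zero (r : ℕ) : divisorSum r 0 = 0 := by
  simp [divisorSum]

/-- By strong induction the proper divisors contribute nothing, so P(n) = 0 for every n ≥ 1, and P
has infinitely many roots. -/
theorem eval_eq_zero_of_sum_divisors {P : Polynomial ℚ}
    (h : ∀ n : ℕ, n ≠ 0 → ∑ v ∈ n.divisors, P.eval (v : ℚ) = 0) : P = 0 := by
  have h0 : ∀ n : ℕ, n ≠ 0 → P.eval (n : ℚ) = 0 := by
    intro n
    induction n using Nat.strong_induction_on with | _ n ih =>
    intro hn
    have := h n hn
    rwa [← Nat.cons_self_properDivisors hn, Finset.sum_cons, Finset.sum_eq_zero, add_zero] at this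
    intro v hv
    have hv' := Nat.mem_properDivisors.1 hv
    exact ih v hv'.2 (by rintro rfl; exact hn (zero_dvd_iff.1 hv'.1))
  refine Polynomial.eq_zero_of_infinite_isRoot P (Set.Infinite.mono ?_
    (Set.infinite_range_of_injective (f := fun n : ℕ => ((n + 1 : ℕ) : ℚ)) fun a b hab => by
      simpa using hab))
  rintro _ ⟨n, rfl⟩
  exact h0 (n + 1) n.succ_ne_zero

/-- The brackets of length at most one are linearly independent. -/
theorem eq_zero_of_evalBrackets_eq_zero {k : ℕ} {d : List ℕ+ →₀ ℚ} (hd : evalBrackets d = 0)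
    (hs : (d.support : Set (List ℕ+)) ⊆ indicesUpTo k 1) : d = 0 := by
  have hsub : d.support ⊆
      insert [] ((Finset.range k).image fun j => ([j.succPNat] : List ℕ+)) := by
    intro s h
    obtain ⟨h1, h2⟩ := hs h
    match s with
    | [] => exact Finset.mem_insert_self _ _
    | [a] =>
      rw [indexWeight_singleton] at h1
      have ha := a.pos
      refine Finset.mem_insert_of_mem (Finset.mem_image.2 ⟨(a : ℕ) - 1,
        Finset.mem_range.2 (by omega), ?_⟩)
      simp only [List.cons.injEq, and_true]
      refine PNat.eq ?_
      simp only [Nat.succPNat_coe, Nat.succ_eq_add_one]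
      omega
    | a :: b :: l => simp at h2
  have hcoeff : ∀ n, d [] * coeff n (bracket []) +
      ∑ j ∈ Finset.range k, d [j.succPNat] * (divisorSum j n / (j.factorial : ℚ)) = 0 := by
    intro n
    have h := coeff_evalBrackets d n
    rw [hd, map_zero, Finsupp.sum_of_support_subset _ hsub _ (by simp), Finset.sum_insert (by simp),
      Finset.sum_image (by intro a _ b _ hab; simpa using hab)] at h
    rw [h]
    simp only [coeff_bracket_singleton, Nat.succPNat_coe, Nat.succ_eq_add_one, Nat.add_sub_cancel]
  -- For n ≥ 1 the n-th coefficient is the sum over v ∣ n of P(v), where P has the coefficients of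
  -- the [j + 1] divided by j!. Once P = 0, the constant coefficient isolates [∅].
  have hP := eval_eq_zero_of_sum_divisors (P := ∑ j ∈ Finset.range k,
    Polynomial.monomial j (d [j.succPNat] / (j.factorial : ℚ))) fun n hn => by
      rw [← hcoeff n, coeff_bracket_nil hn, mul_zero, zero_add]
      simp only [Polynomial.eval_finsetSum, Polynomial.eval_monomial]
      rw [Finset.sum_comm]
      refine Finset.sum_congr rfl fun j _ => ?_
      rw [← Finset.mul_sum, divisorSum, ArithmeticFunction.sigma_apply]
      push_cast
      ring
  have hone : ∀ j < k, d [j.succPNat] = 0 := by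
    intro j hj
    have h := congrArg (fun P => Polynomial.coeff P j) hP
    simp only [Polynomial.finsetSum_coeff, Polynomial.coeff_monomial, Polynomial.coeff_zero] at h
    rw [Finset.sum_ite_eq' (Finset.range k) j, if_pos (Finset.mem_range.2 hj),
      div_eq_zero_iff] at h
    exact h.resolve_right (Nat.cast_ne_zero.2 j.factorial_ne_zero)
  ext s
  by_contra hne
  rcases Finset.mem_insert.1 (hsub (Finsupp.mem_support_iff.2 hne)) with rfl | h
  · have h := hcoeff 0
    simp only [divisorSum_zero, zero_div, mul_zero, Finset.sum_const_zero, add_zero] at h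
    refine hne ((mul_eq_zero.1 h).resolve_right ?_)
    simp only [bracket, coeff_mk, List.map_nil, multipleDivisorSum_nil_zero, List.prod_nil]
    norm_num
  · obtain ⟨j, hj, rfl⟩ := Finset.mem_image.1 h
    exact hne (hone j (Finset.mem_range.1 hj))

/-- The remainder r − r₀ has weight at most 11, while only weight 12 is allowed in length two. It is
therefore a relation of length at most one, hence zero. -/
theorem mem_span_of_representsDelta {r : List ℕ+ →₀ ℚ} (hr : RepresentsDelta r)
    (hs : (r.support : Set (List ℕ+)) ⊆ indicesUpTo 12 1 ∪ pairIndices 12) :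
    r ∈ Submodule.span ℚ (deltaRep '' (deltaPairs : Set (ℕ+ × ℕ+))) := by
  obtain ⟨r₀, hr₀, h1, h2⟩ := exists_sub_support_subset hr (hs.trans union_subset_indicesUpTo)
  have h3 := support_sub_subset hs (support_subset_of_mem_span hr₀)
  have h4 : r - r₀ = 0 := by
    refine eq_zero_of_evalBrackets_eq_zero (k := 11) h2 fun s h => ?_
    obtain ⟨h5, h6⟩ := h1 h
    rcases h3 h with h7 | h7
    · exact ⟨h5, h7.2⟩
    · have := h7.1
      omega
  rwa [sub_eq_zero.1 h4]

/-! ### Uniqueness for each pair -/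

theorem discriminantCoeff_one : discriminantCoeff 1 = 1 := by
  have h : ∀ r, divisorSum r 1 = 1 := fun r => by simp [divisorSum]
  simp only [discriminantCoeff, divisorSumConv, Finset.Nat.antidiagonal_succ, h,
    Finset.Nat.antidiagonal_zero]
  norm_num [divisorSum_zero]

/-- The coefficient of q in Δ is 1, which forces c = 1. -/
theorem eq_smul_deltaRep {r : List ℕ+ →₀ ℚ} (hr : RepresentsDelta r) {p : ℕ+ × ℕ+}
    (hp : p ∈ deltaPairs) {c : ℚ} (h : r = c • deltaRep p) : r = deltaRep p := by
  have h1 := representsDelta_iff.1 hr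
  rw [h, evalBrackets_smul, representsDelta_iff.1 (representsDelta_deltaRep p hp)] at h1
  have h2 := congrArg (coeff 1) h1
  rw [coeff_smul, coeff_mk, discriminantCoeff_one, smul_eq_mul, mul_one] at h2
  rw [h, h2, one_smul]

/-- The six pairs are the edges of the path 2, 4, 6, 8, 10, 11, 12. In a combination of the six, the
coefficient of [x] involves only the edges at x. If it vanishes for all x except a and b, the edges
other than (a, b) can be removed one by one from the two ends of the path, and a multiple of the
representation for (a, b) remains. -/
theorem eq_deltaRep_of_support_subset : ∀ p ∈ deltaPairs, ∀ r : List ℕ+ →₀ ℚ,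
    RepresentsDelta r → (r.support : Set (List ℕ+)) ⊆ {[p.1], [p.2]} ∪ pairIndices 12 →
      r = deltaRep p := by
  intro p hp r hr hs
  have hs' : (r.support : Set (List ℕ+)) ⊆ indicesUpTo 12 1 ∪ pairIndices 12 := by
    refine hs.trans (Set.union_subset_union_left _ ?_)
    have h : ∀ p ∈ deltaPairs, (p.1 : ℕ) ≤ 12 ∧ (p.2 : ℕ) ≤ 12 := by decide
    rintro s (rfl | rfl)
    · exact singleton_mem_indicesUpTo (h p hp).1
    · exact singleton_mem_indicesUpTo (h p hp).2
  have hmem := mem_span_of_representsDelta hr hs'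
  rw [Submodule.mem_span_image_finset_iff_exists_fun'] at hmem
  obtain ⟨c, hc⟩ := hmem
  have hvanish : ∀ x : ℕ+, x ≠ p.1 → x ≠ p.2 → r [x] = 0 := by
    intro x h1 h2
    by_contra h
    rcases hs (Finsupp.mem_support_iff.2 h) with h | h
    · simp only [Set.mem_insert_iff, Set.mem_singleton_iff, List.cons.injEq, and_true] at h
      exact h.elim h1 h2
    · exact absurd h.2 (by simp)
  have hsum : ∀ f : ℕ+ × ℕ+ → List ℕ+ →₀ ℚ, ∑ q ∈ deltaPairs, f q =
      f (2, 4) + f (4, 6) + f (6, 8) + f (8, 10) + f (10, 11) + f (11, 12) := by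
    intro f
    rw [deltaPairs, Finset.sum_insert (by decide), Finset.sum_insert (by decide),
      Finset.sum_insert (by decide), Finset.sum_insert (by decide), Finset.sum_insert (by decide),
      Finset.sum_singleton]
    abel
  rw [hsum] at hc
  have hx : ∀ x : ℕ+, r [x] = c (2, 4) * deltaRep (2, 4) [x] + c (4, 6) * deltaRep (4, 6) [x] +
      c (6, 8) * deltaRep (6, 8) [x] + c (8, 10) * deltaRep (8, 10) [x] +
      c (10, 11) * deltaRep (10, 11) [x] + c (11, 12) * deltaRep (11, 12) [x] := by
    intro x
    rw [← hc]
    rfl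
  simp only [deltaRep_apply_singleton] at hx
  have e2 := hx 2
  have e4 := hx 4
  have e6 := hx 6
  have e8 := hx 8
  have e10 := hx 10
  have e11 := hx 11
  have e12 := hx 12
  simp only [← PNat.coe_inj, PNat.val_ofNat, Nat.reduceEqDiff, Nat.reduceSub, Nat.factorial,
    if_true, if_false, add_zero, zero_add, mul_zero] at e2 e4 e6 e8 e10 e11 e12
  norm_num at e2 e4 e6 e8 e10 e11 e12
  refine eq_smul_deltaRep hr hp (c := c p) ?_
  rw [← hc]
  clear hx hsum hc hs hs' hr
  revert p
  simp only [forall_mem_deltaPairs]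
  refine ⟨fun hv => ?_, fun hv => ?_, fun hv => ?_, fun hv => ?_, fun hv => ?_, fun hv => ?_⟩
  · have c6 : c (11, 12) = 0 := by linarith [hv 12 (by decide) (by decide)]
    have c5 : c (10, 11) = 0 := by linarith [hv 11 (by decide) (by decide)]
    have c4 : c (8, 10) = 0 := by linarith [hv 10 (by decide) (by decide)]
    have c3 : c (6, 8) = 0 := by linarith [hv 8 (by decide) (by decide)]
    have c2 : c (4, 6) = 0 := by linarith [hv 6 (by decide) (by decide)]
    simp only [c2, c3, c4, c5, c6, zero_smul, add_zero]
  · have c1 : c (2, 4) = 0 := by linarith [hv 2 (by decide) (by decide)]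
    have c6 : c (11, 12) = 0 := by linarith [hv 12 (by decide) (by decide)]
    have c5 : c (10, 11) = 0 := by linarith [hv 11 (by decide) (by decide)]
    have c4 : c (8, 10) = 0 := by linarith [hv 10 (by decide) (by decide)]
    have c3 : c (6, 8) = 0 := by linarith [hv 8 (by decide) (by decide)]
    simp only [c1, c3, c4, c5, c6, zero_smul, add_zero, zero_add]
  · have c1 : c (2, 4) = 0 := by linarith [hv 2 (by decide) (by decide)]
    have c2 : c (4, 6) = 0 := by linarith [hv 4 (by decide) (by decide)]
    have c6 : c (11, 12) = 0 := by linarith [hv 12 (by decide) (by decide)]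
    have c5 : c (10, 11) = 0 := by linarith [hv 11 (by decide) (by decide)]
    have c4 : c (8, 10) = 0 := by linarith [hv 10 (by decide) (by decide)]
    simp only [c1, c2, c4, c5, c6, zero_smul, add_zero, zero_add]
  · have c1 : c (2, 4) = 0 := by linarith [hv 2 (by decide) (by decide)]
    have c2 : c (4, 6) = 0 := by linarith [hv 4 (by decide) (by decide)]
    have c3 : c (6, 8) = 0 := by linarith [hv 6 (by decide) (by decide)]
    have c6 : c (11, 12) = 0 := by linarith [hv 12 (by decide) (by decide)]
    have c5 : c (10, 11) = 0 := by linarith [hv 11 (by decide) (by decide)]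
    simp only [c1, c2, c3, c5, c6, zero_smul, add_zero, zero_add]
  · have c1 : c (2, 4) = 0 := by linarith [hv 2 (by decide) (by decide)]
    have c2 : c (4, 6) = 0 := by linarith [hv 4 (by decide) (by decide)]
    have c3 : c (6, 8) = 0 := by linarith [hv 6 (by decide) (by decide)]
    have c4 : c (8, 10) = 0 := by linarith [hv 8 (by decide) (by decide)]
    have c6 : c (11, 12) = 0 := by linarith [hv 12 (by decide) (by decide)]
    simp only [c1, c2, c3, c4, c6, zero_smul, add_zero, zero_add]
  · have c1 : c (2, 4) = 0 := by linarith [hv 2 (by decide) (by decide)]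
    have c2 : c (4, 6) = 0 := by linarith [hv 4 (by decide) (by decide)]
    have c3 : c (6, 8) = 0 := by linarith [hv 6 (by decide) (by decide)]
    have c4 : c (8, 10) = 0 := by linarith [hv 8 (by decide) (by decide)]
    have c5 : c (10, 11) = 0 := by linarith [hv 10 (by decide) (by decide)]
    simp only [c1, c2, c3, c4, c5, zero_smul, add_zero, zero_add]

/-! ### Double shuffle relations between zeta values of weight twelve -/

/-- The zeta value `∑ n⁻ᵏ`. -/
noncomputable def zetaSum (k : ℕ) : ℝ := ∑' n : ℕ+, ((n : ℝ) ^ k)⁻¹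

/-- The double zeta value `∑ (m + n)⁻ᵃ n⁻ᵇ`. -/
noncomputable def doubleZetaSum (a b : ℕ) : ℝ :=
  ∑' p : ℕ+ × ℕ+, (((p.1 : ℝ) + p.2) ^ a * (p.2 : ℝ) ^ b)⁻¹

theorem summable_pnat_pow_inv {k : ℕ} (hk : 2 ≤ k) : Summable fun n : ℕ+ => ((n : ℝ) ^ k)⁻¹ :=
  (Real.summable_nat_pow_inv.2 hk).comp_injective PNat.coe_injective

theorem summable_mul_pow_inv {r s : ℕ} (hr : 2 ≤ r) (hs : 2 ≤ s) :
    Summable fun p : ℕ+ × ℕ+ => ((p.1 : ℝ) ^ r * (p.2 : ℝ) ^ s)⁻¹ := by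
  simp only [mul_inv]
  exact (summable_pnat_pow_inv hr).mul_of_nonneg (summable_pnat_pow_inv hs)
    (fun n => by positivity) (fun n => by positivity)

theorem summable_doubleZetaSum_of_two_le {a b : ℕ} (ha : 2 ≤ a) (hb : 2 ≤ b) :
    Summable fun p : ℕ+ × ℕ+ => (((p.1 : ℝ) + p.2) ^ a * (p.2 : ℝ) ^ b)⁻¹ := by
  have h := (summable_mul_pow_inv ha hb).comp_injective
    (i := fun p : ℕ+ × ℕ+ => (p.1 + p.2, p.2)) fun p q h => by
      simp only [Prod.mk.injEq] at h
      exact Prod.ext (add_right_cancel (h.1.trans (by rw [h.2]))) h.2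
  simpa only [Function.comp_def, PNat.add_coe, Nat.cast_add] using h

/-- Trading a factor m + n for the smaller n dominates the series by the one with exponents (a − 1,
b + 1), both at least 2. This covers b = 1, needed for ζ(11,1). -/
theorem summable_doubleZetaSum {a b : ℕ} (ha : 3 ≤ a) (hb : 1 ≤ b) :
    Summable fun p : ℕ+ × ℕ+ => (((p.1 : ℝ) + p.2) ^ a * (p.2 : ℝ) ^ b)⁻¹ := by
  obtain ⟨a, rfl⟩ := Nat.exists_eq_add_of_le' (show 1 ≤ a by omega)
  refine Summable.of_nonneg_of_le (fun p => by positivity) (fun p => ?_)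
    (summable_doubleZetaSum_of_two_le (show 2 ≤ a by omega) (show 2 ≤ b + 1 by omega))
  have h1 : (0 : ℝ) < p.1 := Nat.cast_pos.2 p.1.pos
  have h2 : (0 : ℝ) < p.2 := Nat.cast_pos.2 p.2.pos
  refine inv_anti₀ (by positivity) ?_
  calc ((p.1 : ℝ) + p.2) ^ a * (p.2 : ℝ) ^ (b + 1) = ((p.1 : ℝ) + p.2) ^ a * (p.2 : ℝ) ^ b * p.2 := by
        ring
    _ ≤ ((p.1 : ℝ) + p.2) ^ a * (p.2 : ℝ) ^ b * (p.1 + p.2) :=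
        mul_le_mul_of_nonneg_left (by linarith) (by positivity)
    _ = ((p.1 : ℝ) + p.2) ^ (a + 1) * (p.2 : ℝ) ^ b := by ring

/-- Pairs of positive integers are of the form `(m + n, n)`, `(n, m + n)` or `(n, n)`. -/
noncomputable def pnatTrichotomy : ((ℕ+ × ℕ+) ⊕ (ℕ+ × ℕ+)) ⊕ ℕ+ ≃ ℕ+ × ℕ+ :=
  Equiv.ofBijective (Sum.elim (Sum.elim (fun p => (p.1 + p.2, p.2)) (fun p => (p.2, p.1 + p.2)))
    (fun n => (n, n))) <| by
    constructor
    · rintro ((⟨a, b⟩ | ⟨a, b⟩) | a) ((⟨c, d⟩ | ⟨c, d⟩) | c) h <;>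
      simp only [Sum.elim_inl, Sum.elim_inr, Prod.mk.injEq, ← PNat.coe_inj, PNat.add_coe,
        Sum.inl.injEq, Sum.inr.injEq, reduceCtorEq] at h ⊢ <;>
      have ha := a.pos <;> have hc := c.pos <;> omega
    · rintro ⟨x, y⟩
      rcases lt_trichotomy x y with h | rfl | h
      · exact ⟨Sum.inl (Sum.inr (y - x, x)), by simp [PNat.sub_add_of_lt h]⟩
      · exact ⟨Sum.inr x, rfl⟩
      · exact ⟨Sum.inl (Sum.inl (x - y, y)), by simp [PNat.sub_add_of_lt h]⟩

theorem zetaSum_mul_zetaSum {r s : ℕ} (hr : 2 ≤ r) (hs : 2 ≤ s) :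
    zetaSum r * zetaSum s = ∑' p : ℕ+ × ℕ+, ((p.1 : ℝ) ^ r * (p.2 : ℝ) ^ s)⁻¹ := by
  rw [zetaSum, zetaSum, (summable_pnat_pow_inv hr).tsum_mul_tsum (summable_pnat_pow_inv hs)]
  · simp only [mul_inv]
  · simpa only [mul_inv] using summable_mul_pow_inv hr hs

theorem zetaSum_stuffle {r s : ℕ} (hr : 2 ≤ r) (hs : 2 ≤ s) :
    zetaSum r * zetaSum s = doubleZetaSum r s + doubleZetaSum s r + zetaSum (r + s) := by
  rw [zetaSum_mul_zetaSum hr hs, ← pnatTrichotomy.tsum_eq]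
  have h1 : HasSum _ (doubleZetaSum r s) := (summable_doubleZetaSum_of_two_le hr hs).hasSum
  have h2 : HasSum _ (doubleZetaSum s r) := (summable_doubleZetaSum_of_two_le hs hr).hasSum
  have h3 : HasSum _ (zetaSum (r + s)) :=
    (summable_pnat_pow_inv (show 2 ≤ r + s by omega)).hasSum
  refine (HasSum.sum (HasSum.sum (h1.congr_fun fun p => ?_) (h2.congr_fun fun p => ?_))
    (h3.congr_fun fun n => ?_)).tsum_eq
  · change (((p.1 + p.2 : ℕ+) : ℝ) ^ r * (p.2 : ℝ) ^ s)⁻¹ = _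
    rw [PNat.add_coe, Nat.cast_add]
  · change ((p.2 : ℝ) ^ r * ((p.1 + p.2 : ℕ+) : ℝ) ^ s)⁻¹ = _
    rw [PNat.add_coe, Nat.cast_add, mul_comm]
  · change ((n : ℝ) ^ r * (n : ℝ) ^ s)⁻¹ = _
    rw [pow_add]

theorem doubleZetaSum_swap (a b : ℕ) :
    doubleZetaSum a b = ∑' p : ℕ+ × ℕ+, (((p.1 : ℝ) + p.2) ^ a * (p.1 : ℝ) ^ b)⁻¹ := by
  rw [doubleZetaSum, ← (Equiv.prodComm ℕ+ ℕ+).tsum_eq]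
  simp [add_comm]

/-- Partial fractions produce denominators n^b and m^b; by the symmetry of m and n both kinds sum to
the same double zeta value. -/
theorem hasSum_doubleZetaSum_symm {a b : ℕ} (ha : 3 ≤ a) (hb : 1 ≤ b) (x y : ℝ) :
    HasSum (fun p : ℕ+ × ℕ+ => x * (((p.1 : ℝ) + p.2) ^ a * (p.2 : ℝ) ^ b)⁻¹ +
      y * (((p.1 : ℝ) + p.2) ^ a * (p.1 : ℝ) ^ b)⁻¹) ((x + y) * doubleZetaSum a b) := by
  rw [add_mul]
  refine ((summable_doubleZetaSum ha hb).hasSum.mul_left x).add (HasSum.mul_left y ?_)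
  rw [doubleZetaSum_swap]
  refine Summable.hasSum ?_
  have h := (Equiv.prodComm ℕ+ ℕ+).summable_iff.2 (summable_doubleZetaSum ha hb)
  simpa [Function.comp_def, add_comm] using h

/-- Partial fractions: m⁻ʳn⁻ˢ is the sum over a + b = r + s of (m + n)⁻ᵃ (C(a−1, r−1) n⁻ᵇ + C(a−1,
s−1) m⁻ᵇ). The two summands of each displayed coefficient are these binomials. -/
theorem zetaSum_shuffle_3_9 : zetaSum 3 * zetaSum 9 =
    (1 + 0) * doubleZetaSum 3 9 +
    (3 + 0) * doubleZetaSum 4 8 +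
    (6 + 0) * doubleZetaSum 5 7 +
    (10 + 0) * doubleZetaSum 6 6 +
    (15 + 0) * doubleZetaSum 7 5 +
    (21 + 0) * doubleZetaSum 8 4 +
    (28 + 1) * doubleZetaSum 9 3 +
    (36 + 9) * doubleZetaSum 10 2 +
    (45 + 45) * doubleZetaSum 11 1 := by
  rw [zetaSum_mul_zetaSum (by norm_num) (by norm_num)]
  refine HasSum.tsum_eq ?_
  convert ((((((((hasSum_doubleZetaSum_symm (a := 3) (b := 9) (by norm_num) (by norm_num) 1 0).add
      (hasSum_doubleZetaSum_symm (a := 4) (b := 8) (by norm_num) (by norm_num) 3 0)).add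
      (hasSum_doubleZetaSum_symm (a := 5) (b := 7) (by norm_num) (by norm_num) 6 0)).add
      (hasSum_doubleZetaSum_symm (a := 6) (b := 6) (by norm_num) (by norm_num) 10 0)).add
      (hasSum_doubleZetaSum_symm (a := 7) (b := 5) (by norm_num) (by norm_num) 15 0)).add
      (hasSum_doubleZetaSum_symm (a := 8) (b := 4) (by norm_num) (by norm_num) 21 0)).add
      (hasSum_doubleZetaSum_symm (a := 9) (b := 3) (by norm_num) (by norm_num) 28 1)).add
      (hasSum_doubleZetaSum_symm (a := 10) (b := 2) (by norm_num) (by norm_num) 36 9)).add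
      (hasSum_doubleZetaSum_symm (a := 11) (b := 1) (by norm_num) (by norm_num) 45 45) using 1
  funext p
  have h1 : (p.1 : ℝ) ≠ 0 := Nat.cast_ne_zero.2 p.1.ne_zero
  have h2 : (p.2 : ℝ) ≠ 0 := Nat.cast_ne_zero.2 p.2.ne_zero
  have h3 : (p.1 : ℝ) + p.2 ≠ 0 := by positivity
  field_simp
  ring

theorem zetaSum_shuffle_4_8 : zetaSum 4 * zetaSum 8 =
    (1 + 0) * doubleZetaSum 4 8 +
    (4 + 0) * doubleZetaSum 5 7 +
    (10 + 0) * doubleZetaSum 6 6 +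
    (20 + 0) * doubleZetaSum 7 5 +
    (35 + 1) * doubleZetaSum 8 4 +
    (56 + 8) * doubleZetaSum 9 3 +
    (84 + 36) * doubleZetaSum 10 2 +
    (120 + 120) * doubleZetaSum 11 1 := by
  rw [zetaSum_mul_zetaSum (by norm_num) (by norm_num)]
  refine HasSum.tsum_eq ?_
  convert (((((((hasSum_doubleZetaSum_symm (a := 4) (b := 8) (by norm_num) (by norm_num) 1 0).add
      (hasSum_doubleZetaSum_symm (a := 5) (b := 7) (by norm_num) (by norm_num) 4 0)).add
      (hasSum_doubleZetaSum_symm (a := 6) (b := 6) (by norm_num) (by norm_num) 10 0)).add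
      (hasSum_doubleZetaSum_symm (a := 7) (b := 5) (by norm_num) (by norm_num) 20 0)).add
      (hasSum_doubleZetaSum_symm (a := 8) (b := 4) (by norm_num) (by norm_num) 35 1)).add
      (hasSum_doubleZetaSum_symm (a := 9) (b := 3) (by norm_num) (by norm_num) 56 8)).add
      (hasSum_doubleZetaSum_symm (a := 10) (b := 2) (by norm_num) (by norm_num) 84 36)).add
      (hasSum_doubleZetaSum_symm (a := 11) (b := 1) (by norm_num) (by norm_num) 120 120) using 1
  funext p
  have h1 : (p.1 : ℝ) ≠ 0 := Nat.cast_ne_zero.2 p.1.ne_zero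
  have h2 : (p.2 : ℝ) ≠ 0 := Nat.cast_ne_zero.2 p.2.ne_zero
  have h3 : (p.1 : ℝ) + p.2 ≠ 0 := by positivity
  field_simp
  ring

theorem zetaSum_shuffle_5_7 : zetaSum 5 * zetaSum 7 =
    (1 + 0) * doubleZetaSum 5 7 +
    (5 + 0) * doubleZetaSum 6 6 +
    (15 + 1) * doubleZetaSum 7 5 +
    (35 + 7) * doubleZetaSum 8 4 +
    (70 + 28) * doubleZetaSum 9 3 +
    (126 + 84) * doubleZetaSum 10 2 +
    (210 + 210) * doubleZetaSum 11 1 := by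
  rw [zetaSum_mul_zetaSum (by norm_num) (by norm_num)]
  refine HasSum.tsum_eq ?_
  convert ((((((hasSum_doubleZetaSum_symm (a := 5) (b := 7) (by norm_num) (by norm_num) 1 0).add
      (hasSum_doubleZetaSum_symm (a := 6) (b := 6) (by norm_num) (by norm_num) 5 0)).add
      (hasSum_doubleZetaSum_symm (a := 7) (b := 5) (by norm_num) (by norm_num) 15 1)).add
      (hasSum_doubleZetaSum_symm (a := 8) (b := 4) (by norm_num) (by norm_num) 35 7)).add
      (hasSum_doubleZetaSum_symm (a := 9) (b := 3) (by norm_num) (by norm_num) 70 28)).add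
      (hasSum_doubleZetaSum_symm (a := 10) (b := 2) (by norm_num) (by norm_num) 126 84)).add
      (hasSum_doubleZetaSum_symm (a := 11) (b := 1) (by norm_num) (by norm_num) 210 210) using 1
  funext p
  have h1 : (p.1 : ℝ) ≠ 0 := Nat.cast_ne_zero.2 p.1.ne_zero
  have h2 : (p.2 : ℝ) ≠ 0 := Nat.cast_ne_zero.2 p.2.ne_zero
  have h3 : (p.1 : ℝ) + p.2 ≠ 0 := by positivity
  field_simp
  ring

/-- A strictly decreasing pair of positive integers is of the form `(m + n, n)`. -/
def strictAntiPairEquiv (a b : ℕ+) :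
    ℕ+ × ℕ+ ≃ {n : Fin [a, b].length → ℕ+ // StrictAnti n} where
  toFun p := ⟨(![p.1 + p.2, p.2] : Fin 2 → ℕ+), by
    refine Fin.strictAnti_iff_succ_lt.2 fun i : Fin 1 => ?_
    obtain rfl := Subsingleton.elim i 0
    exact PNat.lt_add_left _ _⟩
  invFun n := (n.1 ⟨0, by simp⟩ - n.1 ⟨1, by simp⟩, n.1 ⟨1, by simp⟩)
  left_inv p := by
    refine Prod.ext ?_ rfl
    change p.1 + p.2 - p.2 = p.1
    exact PNat.add_sub
  right_inv n := by
    refine Subtype.ext (funext fun i : Fin 2 => ?_)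
    have h : n.1 ⟨1, by simp⟩ < n.1 ⟨0, by simp⟩ := n.2 (by simp)
    fin_cases i
    · exact PNat.sub_add_of_lt h
    · rfl

theorem mzvTerm_strictAntiPairEquiv (a b : ℕ+) (p : ℕ+ × ℕ+) :
    mzvTerm [a, b] (strictAntiPairEquiv a b p) =
      (((p.1 : ℝ) + p.2) ^ (a : ℕ) * (p.2 : ℝ) ^ (b : ℕ))⁻¹ := by
  refine (Fin.prod_univ_two (fun j : Fin 2 => (((![p.1 + p.2, p.2] j : ℕ+) : ℝ) ^
    (([a, b].get j : ℕ+) : ℕ))⁻¹)).trans ?_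
  change (((p.1 + p.2 : ℕ+) : ℝ) ^ (a : ℕ))⁻¹ * ((p.2 : ℝ) ^ (b : ℕ))⁻¹ = _
  rw [PNat.add_coe, Nat.cast_add, mul_inv]

theorem summable_mzvTerm_pair {a b : ℕ+} (ha : 3 ≤ (a : ℕ)) : Summable (mzvTerm [a, b]) := by
  rw [← (strictAntiPairEquiv a b).summable_iff]
  simpa only [Function.comp_def, mzvTerm_strictAntiPairEquiv] using
    summable_doubleZetaSum ha b.pos

theorem multizeta_pair (a b : ℕ+) : multizeta [a, b] = doubleZetaSum a b := by
  rw [multizeta, ← (strictAntiPairEquiv a b).tsum_eq, doubleZetaSum]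
  exact tsum_congr (mzvTerm_strictAntiPairEquiv a b)

/-- Sequences of length one of positive integers. -/
def strictAntiSingletonEquiv (a : ℕ+) : ℕ+ ≃ {n : Fin [a].length → ℕ+ // StrictAnti n} where
  toFun m := ⟨fun _ => m, fun (i : Fin 1) (j : Fin 1) h => absurd h (by simp [Subsingleton.elim i j])⟩
  invFun n := n.1 ⟨0, by simp⟩
  left_inv _ := rfl
  right_inv n := Subtype.ext (funext fun i : Fin 1 => congrArg n.1 (Subsingleton.elim (α := Fin 1) _ _))

theorem mzvTerm_strictAntiSingletonEquiv (a m : ℕ+) :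
    mzvTerm [a] (strictAntiSingletonEquiv a m) = ((m : ℝ) ^ (a : ℕ))⁻¹ :=
  Fin.prod_univ_one (fun j : Fin 1 => ((m : ℝ) ^ (([a].get j : ℕ+) : ℕ))⁻¹)

theorem summable_mzvTerm_singleton {a : ℕ+} (ha : 2 ≤ (a : ℕ)) : Summable (mzvTerm [a]) := by
  rw [← (strictAntiSingletonEquiv a).summable_iff]
  simpa only [Function.comp_def, mzvTerm_strictAntiSingletonEquiv] using summable_pnat_pow_inv ha

theorem multizeta_singleton (a : ℕ+) : multizeta [a] = zetaSum a := by
  rw [multizeta, ← (strictAntiSingletonEquiv a).tsum_eq, zetaSum]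
  exact tsum_congr (mzvTerm_strictAntiSingletonEquiv a)

theorem zetaSum_two_mul {k : ℕ} (hk : k ≠ 0) :
    zetaSum (2 * k) = (-1 : ℝ) ^ (k + 1) * (2 : ℝ) ^ (2 * k - 1) * Real.pi ^ (2 * k) *
      bernoulli (2 * k) / (2 * k).factorial := by
  have h := hasSum_zeta_nat hk
  have h2 : HasSum (fun n : ℕ+ => 1 / ((n : ℕ) : ℝ) ^ (2 * k)) _ :=
    (hasSum_pnat_iff (f := fun n : ℕ => 1 / (n : ℝ) ^ (2 * k))).2 (by simpa [hk] using h)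
  simpa only [one_div, zetaSum] using h2.tsum_eq

theorem zetaSum_four : zetaSum 4 = Real.pi ^ 4 / 90 := by
  rw [show 4 = 2 * 2 from rfl, zetaSum_two_mul two_ne_zero,
    show bernoulli (2 * 2) = -1 / 30 by decide +kernel]
  norm_num [Nat.factorial]
  ring

theorem zetaSum_six : zetaSum 6 = Real.pi ^ 6 / 945 := by
  rw [show 6 = 2 * 3 from rfl, zetaSum_two_mul three_ne_zero,
    show bernoulli (2 * 3) = 1 / 42 by decide +kernel]
  norm_num [Nat.factorial]
  ring

theorem zetaSum_eight : zetaSum 8 = Real.pi ^ 8 / 9450 := by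
  rw [show 8 = 2 * 4 from rfl, zetaSum_two_mul four_ne_zero,
    show bernoulli (2 * 4) = -1 / 30 by decide +kernel]
  norm_num [Nat.factorial]
  ring

theorem zetaSum_twelve : zetaSum 12 = 691 * Real.pi ^ 12 / 638512875 := by
  rw [show 12 = 2 * 6 from rfl, zetaSum_two_mul (by norm_num),
    show bernoulli (2 * 6) = -691 / 2730 by decide +kernel]
  norm_num [Nat.factorial]
  ring

/-- The multipliers eliminate ζ(3)ζ(9), ζ(5)ζ(7) and all double zeta values other than the three on
the right. What is left of ζ(4)ζ(8) and ζ(6)² is a rational multiple of ζ(12), and 691 enters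
through ζ(12) = 691π¹²/638512875. -/
theorem zetaSum_twelve_relation :
    (5197 / 691 : ℝ) * zetaSum 12 =
      168 * doubleZetaSum 5 7 + 150 * doubleZetaSum 7 5 + 28 * doubleZetaSum 9 3 := by
  have s3 := zetaSum_stuffle (r := 3) (s := 9) (by norm_num) (by norm_num)
  have s4 := zetaSum_stuffle (r := 4) (s := 8) (by norm_num) (by norm_num)
  have s5 := zetaSum_stuffle (r := 5) (s := 7) (by norm_num) (by norm_num)
  have s6 := zetaSum_stuffle (r := 6) (s := 6) (by norm_num) (by norm_num)
  simp only [Nat.reduceAdd] at s3 s4 s5 s6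
  have e1 : 691 * (zetaSum 4 * zetaSum 8) = (638512875 / (90 * 9450)) * zetaSum 12 := by
    rw [zetaSum_four, zetaSum_eight, zetaSum_twelve]
    ring
  have e2 : 691 * (zetaSum 6 * zetaSum 6) = (638512875 / (945 * 945)) * zetaSum 12 := by
    rw [zetaSum_six, zetaSum_twelve]
    ring
  linear_combination (308 / 5) * zetaSum_shuffle_3_9 - (308 / 5) * s3 - (672 / 5) * s4 -
    (252 / 5) * zetaSum_shuffle_4_8 + (78 / 5) * zetaSum_shuffle_5_7 - (78 / 5) * s5 - 95 * s6 +
    (924 / 5 / 691) * e1 + (95 / 691) * e2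

theorem mainTheorem10 :
    -- the six representations, collected in a family `R`
    (∃ R : ℕ+ × ℕ+ → (List ℕ+ →₀ ℚ),
      (∀ a b : ℕ+, (a, b) ∈ deltaPairs →
        -- `R (a, b)` is a representation by `[a]`, `[b]` and the `[m, n]` with `m + n = 12`,
        RepresentsDelta (R (a, b)) ∧
        ((R (a, b)).support : Set (List ℕ+)) ⊆ {[a], [b]} ∪ pairIndices 12 ∧
        -- with the given coefficients of `(a-1)! [a]` and `(b-1)! [b]`,
        R (a, b) [a] = (2 ^ (b : ℕ) + 50) / (2 ^ (b : ℕ) - 2 ^ (a : ℕ)) *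
          (((a : ℕ) - 1).factorial : ℚ) ∧
        R (a, b) [b] = (2 ^ (a : ℕ) + 50) / (2 ^ (a : ℕ) - 2 ^ (b : ℕ)) *
          (((b : ℕ) - 1).factorial : ℚ) ∧
        -- and it is the only representation by these brackets
        (∀ r : List ℕ+ →₀ ℚ, RepresentsDelta r →
          (r.support : Set (List ℕ+)) ⊆ {[a], [b]} ∪ pairIndices 12 → r = R (a, b))) ∧
      -- every representation by brackets of length at most one and weight at most 12 and
      -- brackets of length two and weight 12 is a linear combination of the six
      (∀ r : List ℕ+ →₀ ℚ, RepresentsDelta r →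
        (r.support : Set (List ℕ+)) ⊆ indicesUpTo 12 1 ∪ pairIndices 12 →
          r ∈ Submodule.span ℚ (R '' (deltaPairs : Set (ℕ+ × ℕ+)))) ∧
      -- every representation by the generators of `Fil_{12,2}` is a linear combination of the
      -- six, up to a linear relation between the generators of `Fil_{11,2}`
      (∀ r : List ℕ+ →₀ ℚ, RepresentsDelta r →
        (r.support : Set (List ℕ+)) ⊆ indicesUpTo 12 2 →
          ∃ r₀ ∈ Submodule.span ℚ (R '' (deltaPairs : Set (ℕ+ × ℕ+))),
            ((r - r₀).support : Set (List ℕ+)) ⊆ indicesUpTo 11 2 ∧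
            evalBrackets (r - r₀) = 0)) ∧
    -- the resulting relation between convergent multiple zeta values
    (Summable (mzvTerm [12]) ∧ Summable (mzvTerm [5, 7]) ∧ Summable (mzvTerm [7, 5]) ∧
      Summable (mzvTerm [9, 3]) ∧
      (5197 / 691 : ℝ) * multizeta [12] =
        168 * multizeta [5, 7] + 150 * multizeta [7, 5] + 28 * multizeta [9, 3]) := by
  refine ⟨⟨deltaRep, fun a b hab => ⟨representsDelta_deltaRep _ hab, support_deltaRep (a, b), ?_, ?_,
    fun r hr hs => eq_deltaRep_of_support_subset _ hab r hr hs⟩,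
    fun r hr hs => mem_span_of_representsDelta hr hs, fun r hr hs => exists_sub_support_subset hr hs⟩,
    summable_mzvTerm_singleton (by decide), summable_mzvTerm_pair (by decide),
    summable_mzvTerm_pair (by decide), summable_mzvTerm_pair (by decide), ?_⟩
  · have h : ∀ p ∈ deltaPairs, p.2 ≠ p.1 := by decide
    rw [deltaRep_apply_singleton, if_pos rfl, if_neg (h _ hab), add_zero]
  · have h : ∀ p ∈ deltaPairs, p.1 ≠ p.2 := by decide
    rw [deltaRep_apply_singleton, if_pos rfl, if_neg (h _ hab), zero_add]
  · simp only [multizeta_singleton, multizeta_pair, PNat.val_ofNat]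
    exact zetaSum_twelve_relation
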